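/- Let $A$ be a partially ordered set with a top element $\top$ and a bottom element $\bot$, whose elements are called atoms. The class of games over $A$ is the smallest class that contains $[a]$ for every $a\in A$ (the atomic games) and that contains $\{L\mid R\}$ (a composite game, with left options the elements of $L$ and right options the elements of $R$) for all non-empty sets $L,R$ of games; atomic games have no options. The positions of a game are the game itself, its options, their options, and so on; a game is finite if it has finitely many positions. Define relations $\leq$ and $\triangleleft$ on games by mutual recursion: - $G\leq H$ if and only if $G^L\triangleleft H$ for all left options $G^L$ of $G$, and $G\triangleleft H^R$ for all right options $H^R$ of $H$, and, if $G$ or $H$ is atomic, $G\triangleleft H$; - $G\triangleleft H$ if and only if $G^R\leq H$ for some right option $G^R$ of $G$, or $G\leq H^L$ for some left option $H^L$ of $H$, or $G=[a]$ and $H=[b]$ with $a\leq b$ in $A$. Games $G,H$ are equivalent if $G\leq H$ and $H\leq G$. A game $G$ is passable if each of its positions $K$ is atomic, or has a left option $K^L$ with $K\leq K^L$, or has a right option $K^R$ with $K^R\leq K$. A monotone set coloring game $S$ over $A$ consists of a finite set $|S|$ of cells and a monotone payoff function $\pi_S:\{\bot,\top\}^{|S|}\to A$, where $\bot<\top$ and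 $\{\bot,\top\}^{|S|}$ is ordered pointwise. A position of $S$ is a map $p:|S|\to\{\top,\bot,\star\}$, where $\star$ marks an empty cell. Its game $[\![p]\!]$ over $A$ is $[\pi_S(p)]$ if $p$ has no empty cell, and otherwise it is $\{L\mid R\}$, where $L$ (respectively $R$) is the set of games $[\![q]\!]$ for all positions $q$ obtained from $p$ by coloring exactly one empty cell with $\top$ (respectively with $\bot$). Let $[\![S]\!]=[\![p_0]\!]$, where $p_0$ is the position with all cells empty. **Theorem (realizability theorem for monotone set coloring games).** For every finite passable game $G$ over $A$ there is a monotone set coloring game $S$ over $A$ such that $G$ is equivalent to $[\![S]\!]$. -/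

import Mathlib

universe u v

/-- The class of combinatorial games over a set `A` of atoms: every atom is a game, and nonempty
sets of left and of right options form a composite game.  A set of options is given as a family
indexed by a type; two such presentations give the same game, as sets of options, exactly when
they are related by `CGame.Identical` below. -/
inductive CGame (A : Type u) : Type (max u (v + 1))
  | atom (a : A) : CGame A
  | comp (ι κ : Type v) (hι : Nonempty ι) (hκ : Nonempty κ)
      (L : ι → CGame A) (R : κ → CGame A) : CGame A

namespace CGame

variable {A : Type u}

/-- `G` is of the form `[a]`. -/
def IsAtomic (G : CGame.{u, v} A) : Prop := ∃ a : A, G = atom a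

/-- `K` is a left option of `G`; an atomic game has none. -/
def IsLeftOption (K : CGame.{u, v} A) : CGame.{u, v} A → Prop
  | atom _ => False
  | comp _ _ _ _ L _ => ∃ i, K = L i

/-- `K` is a right option of `G`; an atomic game has none. -/
def IsRightOption (K : CGame.{u, v} A) : CGame.{u, v} A → Prop
  | atom _ => False
  | comp _ _ _ _ _ R => ∃ j, K = R j

/-- `K` is a position of `G`: either `G` itself, or an option of a position of `G`. -/
inductive IsPosition (G : CGame.{u, v} A) : CGame.{u, v} A → Prop
  | refl : IsPosition G G
  | left {H K : CGame.{u, v} A} : IsPosition G H → IsLeftOption K H → IsPosition G K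
  | right {H K : CGame.{u, v} A} : IsPosition G H → IsRightOption K H → IsPosition G K

/-- Two presentations describe the same game: the same atom, or hereditarily the same set of left
options and the same set of right options. -/
def Identical : CGame.{u, v} A → CGame.{u, v} A → Prop
  | atom a, atom b => a = b
  | comp _ _ _ _ L R, comp _ _ _ _ L' R' =>
      ((∀ i, ∃ i', Identical (L i) (L' i')) ∧ (∀ i', ∃ i, Identical (L i) (L' i'))) ∧
      ((∀ j, ∃ j', Identical (R j) (R' j')) ∧ (∀ j', ∃ j, Identical (R j) (R' j')))
  | atom _, comp _ _ _ _ _ _ => False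
  | comp _ _ _ _ _ _, atom _ => False

/-- `G` is finite (short): it has only finitely many distinct positions, where presentations of
the same game are not distinguished. -/
def IsFinite (G : CGame.{u, v} A) : Prop :=
  ∃ s : Set (CGame.{u, v} A), s.Finite ∧ ∀ K, IsPosition G K → ∃ K' ∈ s, Identical K K'

section Order

variable [PartialOrder A]

/- The two order relations.  The defining clauses always refer to smaller pairs of games (the last
clause of `LE` refers to `Tri` of the same pair, which refers to smaller pairs only), so that they
have exactly one solution; see `le_iff` and `tri_iff`. -/
mutual

/-- The relation `G ≤ H` on games. -/
inductive LE : CGame.{u, v} A → CGame.{u, v} A → Prop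
  | intro {G H : CGame.{u, v} A}
      (left : ∀ K, IsLeftOption K G → Tri K H)
      (right : ∀ K, IsRightOption K H → Tri G K)
      (atomic : IsAtomic G ∨ IsAtomic H → Tri G H) : LE G H

/-- The relation `G ⊲ H` on games. -/
inductive Tri : CGame.{u, v} A → CGame.{u, v} A → Prop
  | right {G H K : CGame.{u, v} A} (hK : IsRightOption K G) (h : LE K H) : Tri G H
  | left {G H K : CGame.{u, v} A} (hK : IsLeftOption K H) (h : LE G K) : Tri G H
  | atomic {a b : A} (h : a ≤ b) : Tri (atom a) (atom b)

end

theorem le_iff (G H : CGame.{u, v} A) :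
    LE G H ↔ (∀ K, IsLeftOption K G → Tri K H) ∧ (∀ K, IsRightOption K H → Tri G K) ∧
      (IsAtomic G ∨ IsAtomic H → Tri G H) :=
  ⟨fun ⟨h₁, h₂, h₃⟩ => ⟨h₁, h₂, h₃⟩, fun ⟨h₁, h₂, h₃⟩ => ⟨h₁, h₂, h₃⟩⟩

theorem tri_iff (G H : CGame.{u, v} A) :
    Tri G H ↔ (∃ K, IsRightOption K G ∧ LE K H) ∨ (∃ K, IsLeftOption K H ∧ LE G K) ∨
      (∃ a b : A, G = atom a ∧ H = atom b ∧ a ≤ b) := by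
  constructor
  · rintro (⟨hK, h⟩ | ⟨hK, h⟩ | h)
    · exact Or.inl ⟨_, hK, h⟩
    · exact Or.inr (Or.inl ⟨_, hK, h⟩)
    · exact Or.inr (Or.inr ⟨_, _, rfl, rfl, h⟩)
  · rintro (⟨K, hK, h⟩ | ⟨K, hK, h⟩ | ⟨a, b, rfl, rfl, h⟩)
    · exact Tri.right hK h
    · exact Tri.left hK h
    · exact Tri.atomic h

/-- Equivalence of games: `G ≤ H` and `H ≤ G`. -/
def Equivalent (G H : CGame.{u, v} A) : Prop := LE G H ∧ LE H G

/-- `G` is atomic, or has a left option `K` with `G ≤ K`, or a right option `K` with `K ≤ G`. -/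
def IsLocallyPassable (G : CGame.{u, v} A) : Prop :=
  IsAtomic G ∨ (∃ K, IsLeftOption K G ∧ LE G K) ∨ (∃ K, IsRightOption K G ∧ LE K G)

/-- All positions of `G` are locally passable. -/
def IsPassable (G : CGame.{u, v} A) : Prop := ∀ K, IsPosition G K → IsLocallyPassable K

end Order

end CGame

/-- A monotone set coloring game over `A`: a finite set of cells and a monotone payoff function on
the colorings of the cells by the booleans, ordered pointwise.  Here `true = ⊤` is the color of the
left player and `false = ⊥` the color of the right player. -/
structure MonotoneSetColoringGame (A : Type u) [PartialOrder A] where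
  /-- The set of cells. -/
  carrier : Type v
  /-- There are finitely many cells. -/
  finite_carrier : Finite carrier
  /-- The payoff function. -/
  payoff : (carrier → Bool) →o A

namespace MonotoneSetColoringGame

variable {A : Type u} [PartialOrder A]

/-- A position assigns to each cell a color or `none`, which stands for an empty cell. -/
abbrev Position (S : MonotoneSetColoringGame.{u, v} A) : Type v := S.carrier → Option Bool

/-- The position in which the cell `c` of `p` has been colored with `x`. -/
noncomputable def Position.color {S : MonotoneSetColoringGame.{u, v} A} (p : S.Position)
    (c : S.carrier) (x : Bool) : S.Position :=
  open Classical in Function.update p c (some x)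

theorem Position.ncard_color_lt {S : MonotoneSetColoringGame.{u, v} A} (p : S.Position)
    (c : S.carrier) (hc : p c = none) (x : Bool) :
    {d | p.color c x d = none}.ncard < {d | p d = none}.ncard := by
  classical
  have := S.finite_carrier
  refine Set.ncard_lt_ncard (Set.ssubset_iff_of_subset ?_ |>.2 ⟨c, hc, ?_⟩) (Set.toFinite _)
  · intro d hd
    by_cases h : d = c
    · subst h; exact hc
    · simpa [Position.color, Function.update_of_ne h] using hd
  · simp [Position.color]

open Classical in
/-- The combinatorial game of a position `p`.  If there is an empty cell, then the left (right)
options are the games of the positions obtained by coloring one empty cell with `⊤` (with `⊥`).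
Otherwise it is the atom that the payoff function assigns to the coloring. -/
noncomputable def Position.game {S : MonotoneSetColoringGame.{u, v} A} (p : S.Position) :
    CGame.{u, v} A :=
  if h : Nonempty {c : S.carrier // p c = none} then
    CGame.comp {c : S.carrier // p c = none} {c : S.carrier // p c = none} h h
      (fun c => Position.game (p.color c.1 true))
      (fun c => Position.game (p.color c.1 false))
  else
    CGame.atom (S.payoff fun c => (p c).get
      (Option.isSome_iff_ne_none.2 fun hc => h ⟨⟨c, hc⟩⟩))
termination_by {c | p c = none}.ncard
decreasing_by
  · exact Position.ncard_color_lt p c.1 c.2 true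
  · exact Position.ncard_color_lt p c.1 c.2 false

/-- The combinatorial game of `S` is the game of the initial position, where all cells are
empty. -/
noncomputable def game (S : MonotoneSetColoringGame.{u, v} A) : CGame.{u, v} A :=
  Position.game (S := S) fun _ => none

end MonotoneSetColoringGame

/-- A game is realizable if it is equivalent to the game of a monotone set coloring game. -/
def CGame.IsRealizable {A : Type u} [PartialOrder A] (G : CGame.{u, v} A) : Prop :=
  ∃ S : MonotoneSetColoringGame.{u, v} A, CGame.Equivalent G S.game

-- In a set coloring game an extra move never hurts (`Position.Below.game_le`), so `≤` implies `⊲`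
-- as soon as one side is the game of a position. The proof is an induction over options that builds
-- such a game around those of the options.
--
-- Let `G` be composite with realizable options and, up to duality, with a left option `K` such that
-- `G ≤ K`. Let `X` be the least game with `G^L ⊲ X` for all left options and `T` the greatest game
-- with `T ⊲ G^R` for all right options; put `S = {⊤ | X}`. Then `G^L ≤ S`, `G ≤ S ⊲ G` and `G ≤ T ⊲
-- G^R`, where `G ≤ S` is due to `G ≤ K ⊲ X`. These relations alone make `G` equivalent to `{S | {T
-- | ⊥}}`. It remains to realize `{S | {T | ⊥}}`, `{⊤ | X}` and, by nesting `{S, T | ⊥}` and `{⊤ |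
-- U}`, the game `X` (`exists_choice`); `T` is dual.
--
-- Each of these is realized by a `compound`: a small board and several summands are colored at the
-- same time, and the outcome of the board selects the summand whose payoff counts. A second-player
-- strategy on the board that secures the outcome `z` compares the compound with the summand `z`
-- (`game_le_of_hold`, `le_game_of_hold`), and a threat to win the board compares it with `{z | ⊥}`
-- (`game_le_orBot_of_threat`). The difficulty is that a player may move in a summand before the
-- board is settled. For this reason `arena` carries two copies of `S`: if one copy has been
-- disturbed, the opponent turns to the other. What remains are finite checks of strategies on
-- boards with at most six cells.

namespace CGame

variable {A : Type u}

theorem option_induction {P : CGame.{u, v} A → Prop}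
    (h : ∀ G, (∀ K, IsLeftOption K G → P K) → (∀ K, IsRightOption K G → P K) → P G)
    (G : CGame.{u, v} A) : P G := by
  induction G with
  | atom a => exact h _ (fun K hK => hK.elim) (fun K hK => hK.elim)
  | comp ι κ hι hκ L R ihL ihR =>
    refine h _ ?_ ?_
    · rintro K ⟨i, rfl⟩; exact ihL i
    · rintro K ⟨i, rfl⟩; exact ihR i

theorem isAtomic_or_exists_options (G : CGame.{u, v} A) :
    IsAtomic G ∨ ((∃ K, IsLeftOption K G) ∧ ∃ K, IsRightOption K G) := by
  cases G with
  | atom a => exact Or.inl ⟨a, rfl⟩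
  | comp ι κ hι hκ L R =>
    exact Or.inr ⟨hι.elim fun i => ⟨_, i, rfl⟩, hκ.elim fun i => ⟨_, i, rfl⟩⟩

theorem not_isAtomic_comp {ι κ : Type v} {hι : Nonempty ι} {hκ : Nonempty κ}
    {L : ι → CGame.{u, v} A} {R : κ → CGame.{u, v} A} : ¬ IsAtomic (comp ι κ hι hκ L R) := by
  rintro ⟨a, h⟩
  cases h

-- The order on games: transitivity and bounds

section Order

variable [PartialOrder A]

theorem LE.left {G H K : CGame.{u, v} A} (h : LE G H) (hK : IsLeftOption K G) : Tri K H :=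
  ((le_iff G H).1 h).1 K hK

theorem LE.right {G H K : CGame.{u, v} A} (h : LE G H) (hK : IsRightOption K H) : Tri G K :=
  ((le_iff G H).1 h).2.1 K hK

theorem LE.atomic {G H : CGame.{u, v} A} (h : LE G H) (hA : IsAtomic G ∨ IsAtomic H) : Tri G H :=
  ((le_iff G H).1 h).2.2 hA

theorem atom_le_atom {a b : A} (h : a ≤ b) : LE (atom a : CGame.{u, v} A) (atom b) :=
  LE.intro (fun _ hK => hK.elim) (fun _ hK => hK.elim) fun _ => Tri.atomic h

protected theorem LE.refl (G : CGame.{u, v} A) : LE G G := by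
  induction G using option_induction with
  | h G ihL ihR =>
    refine LE.intro (fun K hK => Tri.left hK (ihL K hK)) (fun K hK => Tri.right hK (ihR K hK)) ?_
    rintro (⟨a, rfl⟩ | ⟨a, rfl⟩) <;> exact Tri.atomic le_rfl

theorem tri_of_isLeftOption {G K : CGame.{u, v} A} (h : IsLeftOption K G) : Tri K G :=
  Tri.left h (LE.refl K)

theorem tri_of_isRightOption {G K : CGame.{u, v} A} (h : IsRightOption K G) : Tri G K :=
  Tri.right h (LE.refl K)

/-- The three mixed forms of transitivity need each other on smaller triples, so they are proved
together. -/
theorem trans_aux (G H K : CGame.{u, v} A) :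
    (Tri G H → LE H K → Tri G K) ∧ (LE G H → Tri H K → Tri G K) ∧ (LE G H → LE H K → LE G K) := by
  induction G using option_induction generalizing H K with
  | h G ihGL ihGR =>
  induction H using option_induction generalizing K with
  | h H ihHL ihHR =>
  induction K using option_induction with
  | h K ihKL ihKR =>
  have h₁ : Tri G H → LE H K → Tri G K := by
    intro hGH hHK
    rcases (tri_iff G H).1 hGH with ⟨G', hG', h⟩ | ⟨H', hH', h⟩ | ⟨a, b, rfl, rfl, h⟩
    · exact Tri.right hG' ((ihGR G' hG' H K).2.2 h hHK)
    · exact (ihHL H' hH' K).2.1 h (hHK.left hH')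
    -- The middle game is an atom and has no options to continue with; the atomic clause of `≤`
    -- supplies `H ⊲ K` instead.
    · rcases (tri_iff _ K).1 (hHK.atomic (Or.inl ⟨b, rfl⟩)) with
        ⟨H', hH', _⟩ | ⟨K', hK', h'⟩ | ⟨b', c, hb, rfl, h'⟩
      · exact hH'.elim
      · exact Tri.left hK' ((ihKL K' hK').2.2 (atom_le_atom h) h')
      · cases hb
        exact Tri.atomic (h.trans h')
  have h₂ : LE G H → Tri H K → Tri G K := by
    intro hGH hHK
    rcases (tri_iff H K).1 hHK with ⟨H', hH', h⟩ | ⟨K', hK', h⟩ | ⟨b, c, rfl, rfl, h⟩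
    · exact (ihHR H' hH' K).1 (hGH.right hH') h
    · exact Tri.left hK' ((ihKL K' hK').2.2 hGH h)
    · rcases (tri_iff G _).1 (hGH.atomic (Or.inr ⟨b, rfl⟩)) with
        ⟨G', hG', h'⟩ | ⟨H', hH', _⟩ | ⟨a, b', rfl, hb, h'⟩
      · exact Tri.right hG' ((ihGR G' hG' _ _).2.2 h' (atom_le_atom h))
      · exact hH'.elim
      · cases hb
        exact Tri.atomic (h'.trans h)
  refine ⟨h₁, h₂, fun hGH hHK => LE.intro ?_ ?_ ?_⟩
  · exact fun G' hG' => (ihGL G' hG' H K).1 (hGH.left hG') hHK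
  · exact fun K' hK' => (ihKR K' hK').2.1 hGH (hHK.right hK')
  · rintro (h | h)
    · exact h₁ (hGH.atomic (Or.inl h)) hHK
    · exact h₂ hGH (hHK.atomic (Or.inr h))

protected theorem LE.trans {G H K : CGame.{u, v} A} (h : LE G H) (h' : LE H K) : LE G K :=
  (trans_aux G H K).2.2 h h'

theorem LE.trans_tri {G H K : CGame.{u, v} A} (h : LE G H) (h' : Tri H K) : Tri G K :=
  (trans_aux G H K).2.1 h h'

theorem Tri.trans_le {G H K : CGame.{u, v} A} (h : Tri G H) (h' : LE H K) : Tri G K :=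
  (trans_aux G H K).1 h h'

/-- `⊲` has to be carried along: the clause of `≤` for right options asks for it, and without
passability it does not follow from `≤`. -/
theorem bot_le_aux [OrderBot A] (G : CGame.{u, v} A) : LE (atom ⊥) G ∧ Tri (atom ⊥) G := by
  induction G using option_induction with
  | h G ihL ihR =>
    have h : Tri (atom ⊥) G := by
      rcases isAtomic_or_exists_options G with ⟨a, rfl⟩ | ⟨⟨K, hK⟩, _⟩
      · exact Tri.atomic bot_le
      · exact Tri.left hK (ihL K hK).1
    exact ⟨LE.intro (fun K hK => hK.elim) (fun K hK => (ihR K hK).2) fun _ => h, h⟩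

protected theorem bot_le [OrderBot A] (G : CGame.{u, v} A) : LE (atom ⊥) G := (bot_le_aux G).1

theorem le_top_aux [OrderTop A] (G : CGame.{u, v} A) : LE G (atom ⊤) ∧ Tri G (atom ⊤) := by
  induction G using option_induction with
  | h G ihL ihR =>
    have h : Tri G (atom ⊤) := by
      rcases isAtomic_or_exists_options G with ⟨a, rfl⟩ | ⟨_, K, hK⟩
      · exact Tri.atomic le_top
      · exact Tri.right hK (ihR K hK).1
    exact ⟨LE.intro (fun K hK => (ihL K hK).2) (fun K hK => hK.elim) fun _ => h, h⟩

protected theorem le_top [OrderTop A] (G : CGame.{u, v} A) : LE G (atom ⊤) := (le_top_aux G).1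

theorem Identical.le_and_ge (G H : CGame.{u, v} A) (h : Identical G H) : LE G H ∧ LE H G := by
  induction G generalizing H with
  | atom a =>
    cases H with
    | atom b =>
      rw [Identical] at h
      subst h
      exact ⟨LE.refl _, LE.refl _⟩
    | comp => rw [Identical] at h; exact h.elim
  | comp ι κ hι hκ L R ihL ihR =>
    cases H with
    | atom b => rw [Identical] at h; exact h.elim
    | comp ι' κ' hι' hκ' L' R' =>
      rw [Identical] at h
      obtain ⟨⟨hL, hL'⟩, hR, hR'⟩ := h
      constructor
      · refine LE.intro ?_ ?_ fun h => (h.elim not_isAtomic_comp not_isAtomic_comp).elim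
        · rintro K ⟨i, rfl⟩
          obtain ⟨i', h⟩ := hL i
          exact Tri.left ⟨i', rfl⟩ (ihL i _ h).1
        · rintro K ⟨j', rfl⟩
          obtain ⟨j, h⟩ := hR' j'
          exact Tri.right ⟨j, rfl⟩ (ihR j _ h).1
      · refine LE.intro ?_ ?_ fun h => (h.elim not_isAtomic_comp not_isAtomic_comp).elim
        · rintro K ⟨i', rfl⟩
          obtain ⟨i, h⟩ := hL' i'
          exact Tri.left ⟨i, rfl⟩ (ihL i _ h).2
        · rintro K ⟨j, rfl⟩
          obtain ⟨j', h⟩ := hR j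
          exact Tri.right ⟨j', rfl⟩ (ihR j _ h).2

theorem Identical.equivalent {G H : CGame.{u, v} A} (h : Identical G H) : Equivalent G H :=
  h.le_and_ge

theorem Equivalent.symm {G H : CGame.{u, v} A} (h : Equivalent G H) : Equivalent H G := ⟨h.2, h.1⟩

theorem Equivalent.trans {G H K : CGame.{u, v} A} (h : Equivalent G H) (h' : Equivalent H K) :
    Equivalent G K := ⟨h.1.trans h'.1, h'.2.trans h.2⟩

end Order

end CGame

-- Set coloring games: an extra move never hurts

namespace MonotoneSetColoringGame

open CGame

variable {A : Type u} [PartialOrder A] {S : MonotoneSetColoringGame.{u, v} A}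

theorem Position.color_same (p : S.Position) (c : S.carrier) (x : Bool) :
    p.color c x c = some x := by
  simp [Position.color]

theorem Position.color_of_ne (p : S.Position) {c d : S.carrier} (h : d ≠ c) (x : Bool) :
    p.color c x d = p d := by
  simp [Position.color, h]

theorem isLeftOption_game_iff {p : S.Position} {K : CGame.{u, v} A} :
    IsLeftOption K p.game ↔ ∃ c, p c = none ∧ K = (p.color c true).game := by
  by_cases h : Nonempty {c : S.carrier // p c = none}
  · rw [Position.game, dif_pos h]
    exact ⟨fun ⟨⟨c, hc⟩, hK⟩ => ⟨c, hc, hK⟩, fun ⟨c, hc, hK⟩ => ⟨⟨c, hc⟩, hK⟩⟩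
  · rw [Position.game, dif_neg h]
    exact ⟨fun hK => hK.elim, fun ⟨c, hc, _⟩ => h ⟨⟨c, hc⟩⟩⟩

theorem isRightOption_game_iff {p : S.Position} {K : CGame.{u, v} A} :
    IsRightOption K p.game ↔ ∃ c, p c = none ∧ K = (p.color c false).game := by
  by_cases h : Nonempty {c : S.carrier // p c = none}
  · rw [Position.game, dif_pos h]
    exact ⟨fun ⟨⟨c, hc⟩, hK⟩ => ⟨c, hc, hK⟩, fun ⟨c, hc, hK⟩ => ⟨⟨c, hc⟩, hK⟩⟩
  · rw [Position.game, dif_neg h]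
    exact ⟨fun hK => hK.elim, fun ⟨c, hc, _⟩ => h ⟨⟨c, hc⟩⟩⟩

theorem isLeftOption_color {p : S.Position} {c : S.carrier} (hc : p c = none) :
    IsLeftOption (p.color c true).game p.game := isLeftOption_game_iff.2 ⟨c, hc, rfl⟩

theorem isRightOption_color {p : S.Position} {c : S.carrier} (hc : p c = none) :
    IsRightOption (p.color c false).game p.game := isRightOption_game_iff.2 ⟨c, hc, rfl⟩

theorem not_isAtomic_game {p : S.Position} {c : S.carrier} (hc : p c = none) :
    ¬ IsAtomic p.game := by
  have h : Nonempty {c : S.carrier // p c = none} := ⟨⟨c, hc⟩⟩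
  rw [Position.game, dif_pos h]
  exact not_isAtomic_comp

theorem game_some (w : S.carrier → Bool) :
    Position.game (S := S) (fun c => some (w c)) = atom (S.payoff w) := by
  rw [Position.game, dif_neg (by rintro ⟨c, hc⟩; cases hc)]
  rfl

theorem game_eq_atom {p : S.Position} {w : S.carrier → Bool} (h : ∀ c, p c = some (w c)) :
    p.game = atom (S.payoff w) := by
  rw [← game_some]
  congr 1
  exact funext h

theorem exists_eq_some_of_forall_ne_none {p : S.Position} (h : ∀ c, p c ≠ none) :
    ∃ w : S.carrier → Bool, ∀ c, p c = some (w c) := by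
  choose w hw using fun c => Option.ne_none_iff_exists'.1 (h c)
  exact ⟨w, hw⟩

/-- Induction on the number of empty cells. -/
theorem Position.color_induction {P : S.Position → Prop}
    (h : ∀ p : S.Position, (∀ c x, p c = none → P (p.color c x)) → P p) (p : S.Position) : P p := by
  induction hn : {c | p c = none}.ncard using Nat.strong_induction_on generalizing p with
  | _ n ih =>
    subst hn
    exact h p fun c x hc => ih _ (p.ncard_color_lt c hc x) _ rfl

/-- The pointwise order of positions, for the order in which an empty cell lies between the
two colors. -/
def Position.Below (p q : S.Position) : Prop :=
  ∀ c, (p c = some true → q c = some true) ∧ (q c = some false → p c = some false)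

/-- A move in one position is copied in the same cell of the other. If that cell is already taken
there, the order is preserved anyway, and the spare move can be made in any empty cell, or both
sides are settled by the payoff. -/
theorem Position.Below.game_le {p q : S.Position} (h : p.Below q) : LE p.game q.game := by
  induction p using Position.color_induction generalizing q with
  | h p ihp =>
  induction q using Position.color_induction with
  | h q ihq =>
  have key : ∀ x c, p c = none → q c = none → (p.color c x).Below (q.color c x) := by
    intro x c _ _ d
    by_cases hd : d = c
    · subst hd; simp [Position.color_same]
    · simpa [Position.color_of_ne _ hd] using h d
  have keyl : ∀ c, p c = none → q c ≠ none → ∀ x, (p.color c x).Below q ∨ q c = some (!x) := by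
    intro c hp hq x
    obtain ⟨y, hy⟩ := Option.ne_none_iff_exists'.1 hq
    by_cases hxy : y = x
    · left
      intro d
      by_cases hd : d = c
      · subst hd; simp [Position.color_same, hy, hxy]
      · simpa [Position.color_of_ne _ hd] using h d
    · right
      rw [hy]
      cases x <;> cases y <;> simp_all
  have tri : Tri p.game q.game := by
    by_cases hp : ∃ c, p c = none
    · obtain ⟨c, hc⟩ := hp
      refine Tri.right (isRightOption_color hc) (ihp c false hc ?_)
      intro d
      by_cases hd : d = c
      · subst hd; simp [Position.color_same]
      · simpa [Position.color_of_ne _ hd] using h d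
    · by_cases hq : ∃ c, q c = none
      · obtain ⟨c, hc⟩ := hq
        refine Tri.left (isLeftOption_color hc) (ihq c true hc ?_)
        intro d
        by_cases hd : d = c
        · subst hd; simp [Position.color_same]
        · simpa [Position.color_of_ne _ hd] using h d
      · push Not at hp hq
        obtain ⟨w, hw⟩ := exists_eq_some_of_forall_ne_none hp
        obtain ⟨w', hw'⟩ := exists_eq_some_of_forall_ne_none hq
        rw [game_eq_atom hw, game_eq_atom hw']
        refine Tri.atomic (S.payoff.monotone fun c => ?_)
        have := (h c).1
        rw [hw, hw'] at this
        simp only [Option.some.injEq] at this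
        cases hc : w c
        · exact Bool.false_le _
        · rw [this hc]
  refine LE.intro ?_ ?_ fun _ => tri
  · intro K hK
    obtain ⟨c, hc, rfl⟩ := isLeftOption_game_iff.1 hK
    by_cases hqc : q c = none
    · exact Tri.left (isLeftOption_color hqc) (ihp c true hc (key true c hc hqc))
    -- The cell `c` is not `⊥` in `q`, since it would then be `⊥` in `p`. So it is `⊤` in `q`, and
    -- the move of Left in `p` only catches up with `q`.
    · have hb : (p.color c true).Below q := by
        rcases keyl c hc hqc true with hb | hb
        · exact hb
        · have := (h c).2 hb
          rw [hc] at this; cases this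
      have hle := ihp c true hc hb
      by_cases hq : ∃ d, q d = none
      · obtain ⟨d, hd⟩ := hq
        have hdc : d ≠ c := fun e => hqc (e ▸ hd)
        refine Tri.left (isLeftOption_color hd) (ihp c true hc ?_)
        intro e
        by_cases he : e = d
        · subst he; simp [Position.color_same]
        · simpa [Position.color_of_ne _ he] using hb e
      · push Not at hq
        obtain ⟨w', hw'⟩ := exists_eq_some_of_forall_ne_none hq
        exact hle.atomic (Or.inr ⟨_, game_eq_atom hw'⟩)
  · intro K hK
    obtain ⟨c, hc, rfl⟩ := isRightOption_game_iff.1 hK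
    by_cases hpc : p c = none
    · exact Tri.right (isRightOption_color hpc) (ihp c false hpc (key false c hpc hc))
    · have hb : p.Below (q.color c false) := by
        obtain ⟨y, hy⟩ := Option.ne_none_iff_exists'.1 hpc
        have hy' : y = false := by
          cases y
          · rfl
          · have := (h c).1 hy
            rw [hc] at this; cases this
        intro d
        by_cases hd : d = c
        · subst hd; simp [Position.color_same, hy, hy']
        · simpa [Position.color_of_ne _ hd] using h d
      have hle := ihq c false hc hb
      by_cases hp : ∃ d, p d = none
      · obtain ⟨d, hd⟩ := hp
        refine Tri.right (isRightOption_color hd) (ihp d false hd ?_)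
        intro e
        by_cases he : e = d
        · subst he; simp [Position.color_same]
        · simpa [Position.color_of_ne _ he] using hb e
      · push Not at hp
        obtain ⟨w', hw'⟩ := exists_eq_some_of_forall_ne_none hp
        exact hle.atomic (Or.inl ⟨_, game_eq_atom hw'⟩)

theorem Position.below_color_true {p : S.Position} {c : S.carrier} (hc : p c = none) :
    p.Below (p.color c true) := by
  intro d
  by_cases hd : d = c
  · subst hd; simp [Position.color_same]
  · simp [Position.color_of_ne _ hd]

theorem Position.below_color_false {p : S.Position} {c : S.carrier} (hc : p c = none) :
    (p.color c false).Below p := by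
  intro d
  by_cases hd : d = c
  · subst hd; simp [Position.color_same]
  · simp [Position.color_of_ne _ hd]

/-- Left uses the move in any empty cell. For arbitrary games `≤` does not imply `⊲`. -/
theorem tri_game_of_le {K : CGame.{u, v} A} {p : S.Position} (h : LE K p.game) : Tri K p.game := by
  by_cases hp : ∃ c, p c = none
  · obtain ⟨c, hc⟩ := hp
    exact Tri.left (isLeftOption_color hc) (h.trans (Position.below_color_true hc).game_le)
  · push Not at hp
    obtain ⟨w, hw⟩ := exists_eq_some_of_forall_ne_none hp
    exact h.atomic (Or.inr ⟨_, game_eq_atom hw⟩)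

theorem game_tri_of_le {K : CGame.{u, v} A} {p : S.Position} (h : LE p.game K) : Tri p.game K := by
  by_cases hp : ∃ c, p c = none
  · obtain ⟨c, hc⟩ := hp
    exact Tri.right (isRightOption_color hc) ((Position.below_color_false hc).game_le.trans h)
  · push Not at hp
    obtain ⟨w, hw⟩ := exists_eq_some_of_forall_ne_none hp
    exact h.atomic (Or.inl ⟨_, game_eq_atom hw⟩)

end MonotoneSetColoringGame

-- Games with a threat of `⊥`

namespace CGame

variable {A : Type u} [PartialOrder A] [OrderBot A]

/-- The game in which Left has to move to `G` before Right moves to `⊥`. -/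
def orBot (G : CGame.{u, v} A) : CGame.{u, v} A :=
  comp PUnit PUnit ⟨⟨⟩⟩ ⟨⟨⟩⟩ (fun _ => G) (fun _ => atom ⊥)

theorem isLeftOption_orBot (G : CGame.{u, v} A) : IsLeftOption G (orBot G) := ⟨⟨⟩, rfl⟩

theorem isRightOption_orBot (G : CGame.{u, v} A) : IsRightOption (atom ⊥) (orBot G) := ⟨⟨⟩, rfl⟩

/-- The threat of `⊥` settles every clause of `≤` except the one for the only left option. -/
theorem orBot_le {G H : CGame.{u, v} A} (h : Tri G H) : LE (orBot G) H := by
  refine LE.intro ?_ (fun K _ => Tri.right (isRightOption_orBot G) (CGame.bot_le K))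
    fun _ => Tri.right (isRightOption_orBot G) (CGame.bot_le H)
  rintro K ⟨_, rfl⟩
  exact h

end CGame

-- Boards and strategies on them

/-- The outcome of the play on a board: a win for one of the players, or one of three games that
are still to be played. -/
inductive Outcome
  | bot | top | fst | snd | trd
  deriving DecidableEq

namespace Outcome

instance : Finite Outcome :=
  Finite.of_surjective (fun i : Fin 5 => match i with
    | 0 => bot | 1 => top | 2 => fst | 3 => snd | 4 => trd) fun z => by
    cases z
    exacts [⟨0, rfl⟩, ⟨1, rfl⟩, ⟨2, rfl⟩, ⟨3, rfl⟩, ⟨4, rfl⟩]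

/-- `z'` is `⊥` or `z`. -/
def upTo (z z' : Outcome) : Bool := decide (z' = bot) || decide (z' = z)

/-- `z'` is `⊤` or `z`. -/
def atLeast (z z' : Outcome) : Bool := decide (z' = top) || decide (z' = z)

end Outcome

/-- A board with finitely many cells, whose colorings are encoded as bit masks of the cells
colored `⊤`, and with a monotone outcome, where different outcomes are comparable only if one
of them is `⊥` or `⊤`. -/
structure Board where
  /-- The number of cells. -/
  size : ℕ
  /-- The outcome of a coloring. -/
  outcome : ℕ → Outcome
  /-- The outcome is monotone. -/
  mono : ∀ l l', l < 2 ^ size → l' < 2 ^ size → l &&& l' = l →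
    outcome l = outcome l' ∨ outcome l = .bot ∨ outcome l' = .top

namespace Board

/-- The position in which the cell `i` of `s` has been colored with `x`.  A position is given by
the bit mask of the cells colored `⊤` and the bit mask of the cells colored `⊥`. -/
def put (x : Bool) (i : ℕ) (s : ℕ × ℕ) : ℕ × ℕ :=
  match x with
  | true => (s.1 ||| 2 ^ i, s.2)
  | false => (s.1, s.2 ||| 2 ^ i)

/-- The color of the cell `i` in the position `s`. -/
def cell (s : ℕ × ℕ) (i : ℕ) : Option Bool :=
  if s.1.testBit i then some true else if s.2.testBit i then some false else none

theorem cell_eq_none {s : ℕ × ℕ} {i : ℕ} :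
    cell s i = none ↔ s.1.testBit i = false ∧ s.2.testBit i = false := by
  unfold cell
  split_ifs with h h' <;> simp_all

theorem cell_put_same {s : ℕ × ℕ} {i : ℕ} (h : cell s i = none) (x : Bool) :
    cell (put x i s) i = some x := by
  rw [cell_eq_none] at h
  cases x <;> simp [cell, put, Nat.testBit_or, h]

theorem cell_put_of_ne {s : ℕ × ℕ} {i j : ℕ} (h : j ≠ i) (x : Bool) :
    cell (put x i s) j = cell s j := by
  have h₁ : ∀ m : ℕ, (m ||| 2 ^ i).testBit j = m.testBit j := fun m => by
    rw [Nat.testBit_or, Nat.testBit_two_pow_of_ne h.symm, Bool.or_false]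
  cases x
  · unfold cell put
    rw [h₁]
  · unfold cell put
    rw [h₁]

variable (B : Board)

/-- The empty cells of a position. -/
def free (s : ℕ × ℕ) : List ℕ :=
  (List.range B.size).filter fun i => !s.1.testBit i && !s.2.testBit i

theorem mem_free {s : ℕ × ℕ} {i : ℕ} : i ∈ B.free s ↔ i < B.size ∧ cell s i = none := by
  simp [free, cell_eq_none]

/-- With `k` empty cells left, the player with the color `x`, moving second, can force an outcome
in `D`. -/
def hold (x : Bool) (D : Outcome → Bool) : ℕ → ℕ × ℕ → Bool
  | 0, s => (B.free s).isEmpty && D (B.outcome (s.1 % 2 ^ B.size))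
  | 1, s => !(B.free s).isEmpty && (B.free s).all fun c => hold x D 0 (put (!x) c s)
  | k + 2, s => !(B.free s).isEmpty && (B.free s).all fun c =>
      (B.free (put (!x) c s)).any fun d => hold x D k (put x d (put (!x) c s))

/-- With `k + 1` empty cells left, the player with the color `x`, moving first, can force an
outcome in `D`. -/
def force (x : Bool) (D : Outcome → Bool) (k : ℕ) (s : ℕ × ℕ) : Bool :=
  (B.free s).any fun d => B.hold x D k (put x d s)

/-- With `k` empty cells left and Left to move, Right can force `⊥` if Left does not move, and
otherwise Right can force the outcome `z`. -/
def threat (z : Outcome) : ℕ → ℕ × ℕ → Bool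
  | 0, _ => false
  | 1, s => B.force false (fun z' => decide (z' = .bot)) 0 s &&
      (B.free s).all fun c => B.hold false z.upTo 0 (put true c s)
  | k + 2, s => B.force false (fun z' => decide (z' = .bot)) (k + 1) s &&
      (B.free s).all fun c => B.hold false z.upTo (k + 1) (put true c s) ||
        (B.free (put true c s)).any fun d => threat z k (put false d (put true c s))

theorem force_iff {x : Bool} {D : Outcome → Bool} {k : ℕ} {s : ℕ × ℕ} :
    B.force x D k s ↔ ∃ d ∈ B.free s, B.hold x D k (put x d s) := by
  simp [force]

theorem hold_zero {x : Bool} {D : Outcome → Bool} {s : ℕ × ℕ} (h : B.hold x D 0 s) :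
    B.free s = [] ∧ D (B.outcome (s.1 % 2 ^ B.size)) := by
  simpa [hold] using h

theorem hold_one {x : Bool} {D : Outcome → Bool} {s : ℕ × ℕ} (h : B.hold x D 1 s) :
    B.free s ≠ [] ∧ ∀ c ∈ B.free s, B.hold x D 0 (put (!x) c s) := by
  simpa only [hold, Bool.and_eq_true, Bool.not_eq_true', List.isEmpty_eq_false_iff,
    List.all_eq_true] using h

theorem hold_add_two {x : Bool} {D : Outcome → Bool} {k : ℕ} {s : ℕ × ℕ}
    (h : B.hold x D (k + 2) s) :
    B.free s ≠ [] ∧ ∀ c ∈ B.free s, ∃ d ∈ B.free (put (!x) c s),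
      B.hold x D k (put x d (put (!x) c s)) := by
  simpa only [hold, Bool.and_eq_true, Bool.not_eq_true', List.isEmpty_eq_false_iff,
    List.all_eq_true, List.any_eq_true] using h

theorem threat_add_one {z : Outcome} {k : ℕ} {s : ℕ × ℕ} (h : B.threat z (k + 1) s) :
    B.force false (fun z' => decide (z' = .bot)) k s ∧ ∀ c ∈ B.free s,
      B.hold false z.upTo k (put true c s) ∨ ∃ k' < k + 1, ∃ d ∈ B.free (put true c s),
        B.threat z k' (put false d (put true c s)) := by
  cases k with
  | zero =>
    simp only [threat, Bool.and_eq_true, List.all_eq_true] at h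
    exact ⟨h.1, fun c hc => Or.inl (h.2 c hc)⟩
  | succ k =>
    simp only [threat, Bool.and_eq_true, List.all_eq_true, Bool.or_eq_true, List.any_eq_true] at h
    exact ⟨h.1, fun c hc => (h.2 c hc).imp_right fun h => ⟨k, by omega, h⟩⟩

end Board

-- Compounds of a board and summands

namespace MonotoneSetColoringGame

open CGame Board

variable {A : Type u} [PartialOrder A]

/-- The set coloring game without cells and with payoff `a`. -/
def constant (a : A) : MonotoneSetColoringGame.{u, v} A where
  carrier := PEmpty
  finite_carrier := inferInstance
  payoff := ⟨fun _ => a, fun _ _ _ => le_rfl⟩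

theorem game_constant (a : A) (p : (constant.{u, v} a).Position) : p.game = atom a :=
  game_eq_atom (S := constant a) (w := fun _ => true) (nofun : ∀ _ : PEmpty, _)

section Compound

variable [BoundedOrder A] (B : Board) (S₁ S₂ S₃ : MonotoneSetColoringGame.{u, v} A)

/-- The set coloring game that is to be played after a given outcome of the board. -/
def summand : Outcome → MonotoneSetColoringGame.{u, v} A
  | .bot => constant ⊥
  | .top => constant ⊤
  | .fst => S₁
  | .snd => S₂
  | .trd => S₃

/-- The set coloring game played on the cells of the board `B` and of all summands, where the
payoff is that of the summand determined by the outcome of the board. -/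
@[reducible] def compound : MonotoneSetColoringGame.{u, v} A where
  carrier := ULift.{v} (Fin B.size) ⊕ Σ z, (summand S₁ S₂ S₃ z).carrier
  finite_carrier := by
    have := fun z => (summand S₁ S₂ S₃ z).finite_carrier
    infer_instance
  payoff :=
    { toFun := fun w => (summand S₁ S₂ S₃
        (B.outcome (Nat.ofBits fun i => w (Sum.inl ⟨i⟩)))).payoff fun e => w (Sum.inr ⟨_, e⟩)
      monotone' := by
        intro w w' h
        -- Submasks encode the pointwise order of colorings. Distinct outcomes are then comparable
        -- only through `⊥` or `⊤`, so payoffs of two different summands in play never have to be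
        -- compared.
        have hbits : Nat.ofBits (fun i => w (Sum.inl ⟨i⟩)) &&& Nat.ofBits (fun i => w' (Sum.inl ⟨i⟩))
            = Nat.ofBits (fun i : Fin B.size => w (Sum.inl ⟨i⟩)) := by
          refine Nat.eq_of_testBit_eq fun i => ?_
          rw [Nat.testBit_and]
          by_cases hi : i < B.size
          · rw [Nat.testBit_ofBits_lt _ _ hi, Nat.testBit_ofBits_lt _ _ hi]
            have := h (Sum.inl ⟨⟨i, hi⟩⟩)
            revert this
            cases w (Sum.inl ⟨⟨i, hi⟩⟩) <;> cases w' (Sum.inl ⟨⟨i, hi⟩⟩) <;> simp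
          · rw [Nat.testBit_ofBits_ge _ _ (not_lt.1 hi)]
            simp
        rcases B.mono _ _ (Nat.ofBits_lt_two_pow _) (Nat.ofBits_lt_two_pow _) hbits with
          h' | h' | h'
        · dsimp only
          rw [h']
          exact (summand S₁ S₂ S₃ _).payoff.monotone fun e => h _
        · dsimp only
          rw [h']
          exact bot_le
        · dsimp only
          rw [h']
          exact le_top }

variable {B S₁ S₂ S₃}

/-- The position of the compound with position `s` on the board and the positions `σ` in the
summands. -/
def place (s : ℕ × ℕ) (σ : ∀ z, (summand S₁ S₂ S₃ z).Position) :
    (compound B S₁ S₂ S₃).Position :=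
  Sum.elim (fun i => cell s i.down) (fun e => σ e.1 e.2)

theorem place_empty :
    place (0, 0) (fun _ _ => none) = (fun _ => none : (compound B S₁ S₂ S₃).Position) := by
  funext c
  rcases c with i | e <;> simp [place, cell]

theorem place_board_eq_none {s : ℕ × ℕ} {i : ℕ} (hi : i ∈ B.free s)
    (σ : ∀ z, (summand S₁ S₂ S₃ z).Position) :
    place (B := B) s σ (Sum.inl ⟨⟨i, (B.mem_free.1 hi).1⟩⟩) = none :=
  (B.mem_free.1 hi).2

theorem color_place_board {s : ℕ × ℕ} {i : ℕ} (hi : i ∈ B.free s)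
    (σ : ∀ z, (summand S₁ S₂ S₃ z).Position) (x : Bool) :
    (place (B := B) s σ).color (Sum.inl ⟨⟨i, (B.mem_free.1 hi).1⟩⟩) x = place (put x i s) σ := by
  funext c
  by_cases hc : c = Sum.inl ⟨⟨i, (B.mem_free.1 hi).1⟩⟩
  · subst hc
    rw [Position.color_same]
    exact (cell_put_same (B.mem_free.1 hi).2 x).symm
  · rw [Position.color_of_ne _ hc]
    rcases c with j | e
    · refine (cell_put_of_ne (fun h => hc ?_) x).symm
      congr 1
      exact ULift.ext _ _ (Fin.ext h)
    · rfl

theorem color_place_summand (s : ℕ × ℕ) (σ : ∀ z, (summand S₁ S₂ S₃ z).Position) (z : Outcome)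
    (e : (summand S₁ S₂ S₃ z).carrier) (x : Bool) :
    (place (B := B) s σ).color (Sum.inr ⟨z, e⟩) x =
      place s (Function.update σ z ((σ z).color e x)) := by
  funext c
  by_cases hc : c = Sum.inr ⟨z, e⟩
  · subst hc
    rw [Position.color_same]
    simp [place, Position.color_same]
  · rw [Position.color_of_ne _ hc]
    rcases c with j | ⟨z', e'⟩
    · rfl
    · by_cases hz : z' = z
      · subst hz
        have he : e' ≠ e := fun h => hc (h ▸ rfl)
        simp [place, Position.color_of_ne _ he]
      · simp [place, hz]

theorem exists_of_isLeftOption_place {s : ℕ × ℕ} {σ : ∀ z, (summand S₁ S₂ S₃ z).Position}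
    {K : CGame.{u, v} A} (h : IsLeftOption K (place (B := B) s σ).game) :
    (∃ i ∈ B.free s, K = (place (B := B) (put true i s) σ).game) ∨
      ∃ z e, σ z e = none ∧
        K = (place (B := B) s (Function.update σ z ((σ z).color e true))).game := by
  obtain ⟨c, hc, rfl⟩ := isLeftOption_game_iff.1 h
  rcases c with ⟨i, hi⟩ | ⟨z, e⟩
  · have hf : i ∈ B.free s := B.mem_free.2 ⟨hi, hc⟩
    exact Or.inl ⟨i, hf, by rw [← color_place_board hf]⟩
  · exact Or.inr ⟨z, e, hc, by rw [color_place_summand]⟩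

theorem exists_of_isRightOption_place {s : ℕ × ℕ} {σ : ∀ z, (summand S₁ S₂ S₃ z).Position}
    {K : CGame.{u, v} A} (h : IsRightOption K (place (B := B) s σ).game) :
    (∃ i ∈ B.free s, K = (place (B := B) (put false i s) σ).game) ∨
      ∃ z e, σ z e = none ∧
        K = (place (B := B) s (Function.update σ z ((σ z).color e false))).game := by
  obtain ⟨c, hc, rfl⟩ := isRightOption_game_iff.1 h
  rcases c with ⟨i, hi⟩ | ⟨z, e⟩
  · have hf : i ∈ B.free s := B.mem_free.2 ⟨hi, hc⟩
    exact Or.inl ⟨i, hf, by rw [← color_place_board hf]⟩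
  · exact Or.inr ⟨z, e, hc, by rw [color_place_summand]⟩

theorem isLeftOption_board {s : ℕ × ℕ} {i : ℕ} (hi : i ∈ B.free s)
    (σ : ∀ z, (summand S₁ S₂ S₃ z).Position) :
    IsLeftOption (place (B := B) (put true i s) σ).game (place (B := B) s σ).game := by
  rw [← color_place_board hi]
  exact isLeftOption_color (place_board_eq_none hi σ)

theorem isRightOption_board {s : ℕ × ℕ} {i : ℕ} (hi : i ∈ B.free s)
    (σ : ∀ z, (summand S₁ S₂ S₃ z).Position) :
    IsRightOption (place (B := B) (put false i s) σ).game (place (B := B) s σ).game := by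
  rw [← color_place_board hi]
  exact isRightOption_color (place_board_eq_none hi σ)

theorem isLeftOption_summand (s : ℕ × ℕ) {σ : ∀ z, (summand S₁ S₂ S₃ z).Position} {z : Outcome}
    {e : (summand S₁ S₂ S₃ z).carrier} (he : σ z e = none) :
    IsLeftOption (place (B := B) s (Function.update σ z ((σ z).color e true))).game
      (place (B := B) s σ).game := by
  rw [← color_place_summand]
  exact isLeftOption_color (S := compound B S₁ S₂ S₃) he

theorem isRightOption_summand (s : ℕ × ℕ) {σ : ∀ z, (summand S₁ S₂ S₃ z).Position} {z : Outcome}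
    {e : (summand S₁ S₂ S₃ z).carrier} (he : σ z e = none) :
    IsRightOption (place (B := B) s (Function.update σ z ((σ z).color e false))).game
      (place (B := B) s σ).game := by
  rw [← color_place_summand]
  exact isRightOption_color (S := compound B S₁ S₂ S₃) he

theorem ncard_board_lt {s : ℕ × ℕ} {i : ℕ} (hi : i ∈ B.free s)
    (σ : ∀ z, (summand S₁ S₂ S₃ z).Position) (x : Bool) :
    {c | place (B := B) (put x i s) σ c = none}.ncard <
      {c | place (B := B) s σ c = none}.ncard := by
  rw [← color_place_board hi]
  exact Position.ncard_color_lt _ _ (place_board_eq_none hi σ) x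

theorem ncard_summand_lt (s : ℕ × ℕ) {σ : ∀ z, (summand S₁ S₂ S₃ z).Position} {z : Outcome}
    {e : (summand S₁ S₂ S₃ z).carrier} (he : σ z e = none) (x : Bool) :
    {c | place (B := B) s (Function.update σ z ((σ z).color e x)) c = none}.ncard <
      {c | place (B := B) s σ c = none}.ncard := by
  rw [← color_place_summand]
  exact Position.ncard_color_lt (S := compound B S₁ S₂ S₃) _ _ he x

theorem board_true_ge {s : ℕ × ℕ} {i : ℕ} (hi : i ∈ B.free s)
    (σ : ∀ z, (summand S₁ S₂ S₃ z).Position) :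
    LE (place (B := B) s σ).game (place (B := B) (put true i s) σ).game := by
  rw [← color_place_board hi]
  exact (Position.below_color_true (place_board_eq_none hi σ)).game_le

theorem board_false_le {s : ℕ × ℕ} {i : ℕ} (hi : i ∈ B.free s)
    (σ : ∀ z, (summand S₁ S₂ S₃ z).Position) :
    LE (place (B := B) (put false i s) σ).game (place (B := B) s σ).game := by
  rw [← color_place_board hi]
  exact (Position.below_color_false (place_board_eq_none hi σ)).game_le

theorem summand_true_ge (s : ℕ × ℕ) {σ : ∀ z, (summand S₁ S₂ S₃ z).Position} {z : Outcome}
    {e : (summand S₁ S₂ S₃ z).carrier} (he : σ z e = none) :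
    LE (place (B := B) s σ).game
      (place (B := B) s (Function.update σ z ((σ z).color e true))).game := by
  rw [← color_place_summand]
  exact (Position.below_color_true (S := compound B S₁ S₂ S₃) he).game_le

theorem summand_false_le (s : ℕ × ℕ) {σ : ∀ z, (summand S₁ S₂ S₃ z).Position} {z : Outcome}
    {e : (summand S₁ S₂ S₃ z).carrier} (he : σ z e = none) :
    LE (place (B := B) s (Function.update σ z ((σ z).color e false))).game
      (place (B := B) s σ).game := by
  rw [← color_place_summand]
  exact (Position.below_color_false (S := compound B S₁ S₂ S₃) he).game_le

/-- A position without empty cells is an atom, and so are its components. -/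
theorem game_place_full {s : ℕ × ℕ} {σ : ∀ z, (summand S₁ S₂ S₃ z).Position}
    (hs : B.free s = []) (hσ : ∀ z e, σ z e ≠ none) :
    ∃ w : ∀ z, (summand S₁ S₂ S₃ z).carrier → Bool,
      (∀ z, (σ z).game = atom ((summand S₁ S₂ S₃ z).payoff (w z))) ∧
      (place (B := B) s σ).game = atom ((summand S₁ S₂ S₃ (B.outcome (s.1 % 2 ^ B.size))).payoff
        (w _)) := by
  choose w hw using fun z => exists_eq_some_of_forall_ne_none (hσ z)
  refine ⟨w, fun z => game_eq_atom (hw z), ?_⟩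
  have hcell : ∀ i : Fin B.size, cell s i = some (s.1.testBit i) := by
    intro i
    have hi : ¬ cell s i = none := fun h => by
      have := B.mem_free.2 ⟨i.2, h⟩
      rw [hs] at this
      cases this
    unfold cell at hi ⊢
    split_ifs at hi ⊢ with h h' <;> simp_all
  rw [game_eq_atom (S := compound B S₁ S₂ S₃)
    (w := Sum.elim (fun i => s.1.testBit i.down) (fun e => w e.1 e.2))]
  · have : Nat.ofBits (fun i : Fin B.size => s.1.testBit i) = s.1 % 2 ^ B.size :=
      Nat.ofBits_testBit ..
    rw [← this]
    rfl
  · rintro (i | e)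
    · exact hcell i.down
    · exact hw e.1 e.2

/-- Right answers on the board by the strategy and answers each move in the summand `z` by the same
move in the other component. A move of Left in another summand is irrelevant, and the turn it gives
to Right does no harm by `tri_game_of_le`. -/
theorem game_le_of_hold {z : Outcome} {k : ℕ} {s : ℕ × ℕ} {D : Outcome → Bool}
    (hD : ∀ z', D z' → z' = .bot ∨ z' = z) (h : B.hold false D k s)
    (σ : ∀ z, (summand S₁ S₂ S₃ z).Position) :
    LE (place (B := B) s σ).game (σ z).game := by
  induction hn : {c | place (B := B) s σ c = none}.ncard using Nat.strong_induction_on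
    generalizing s σ k with
  | _ n ih =>
  subst hn
  have ihz : ∀ e x, σ z e = none →
      LE (place (B := B) s (Function.update σ z ((σ z).color e x))).game
        ((σ z).color e x).game := by
    intro e x he
    simpa using ih _ (ncard_summand_lt s he x) h _ rfl
  have ihne : ∀ z' e x, z' ≠ z → σ z' e = none →
      LE (place (B := B) s (Function.update σ z' ((σ z').color e x))).game (σ z).game := by
    intro z' e x hz' he
    simpa [hz'.symm] using ih _ (ncard_summand_lt s he x) h _ rfl
  have tri : Tri (place (B := B) s σ).game (σ z).game := by
    by_cases h₁ : ∃ e, σ z e = none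
    · obtain ⟨e, he⟩ := h₁
      exact Tri.left (isLeftOption_color he) ((summand_true_ge s he).trans (ihz e true he))
    by_cases h₂ : ∃ z' e, σ z' e = none
    · obtain ⟨z', e, he⟩ := h₂
      have hz' : z' ≠ z := by
        rintro rfl
        exact h₁ ⟨e, he⟩
      exact Tri.right (isRightOption_summand s he) (ihne z' e false hz' he)
    push Not at h₂
    match k, h with
    | 0, h =>
      obtain ⟨hs, ho⟩ := B.hold_zero h
      obtain ⟨w, hw, hp⟩ := game_place_full hs h₂
      rw [hw, hp]
      refine Tri.atomic ?_
      rcases hD _ ho with h | h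
      · rw [h]
        exact bot_le
      · rw [h]
    | 1, h =>
      obtain ⟨hs, hc⟩ := B.hold_one h
      obtain ⟨c, hcs⟩ := List.exists_mem_of_ne_nil _ hs
      -- The strategy secures the outcome even if Left gets the last cell; by monotonicity it does
      -- so if Right takes it.
      exact Tri.right (isRightOption_board hcs σ) ((board_false_le hcs σ).trans
        ((board_true_ge hcs σ).trans (ih _ (ncard_board_lt hcs σ true) (hc c hcs) σ rfl)))
    | k + 2, h =>
      obtain ⟨hs, hc⟩ := B.hold_add_two h
      obtain ⟨c, hcs⟩ := List.exists_mem_of_ne_nil _ hs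
      obtain ⟨d, hd, hk⟩ := hc c hcs
      have hcd : d ≠ c := by
        rintro rfl
        have := (B.mem_free.1 hd).2
        rw [cell_put_same (B.mem_free.1 hcs).2] at this
        cases this
      have hds : d ∈ B.free s := by
        rw [B.mem_free] at hd ⊢
        rwa [cell_put_of_ne hcd] at hd
      have hcs' : c ∈ B.free (put false d s) := by
        rw [B.mem_free] at hcs ⊢
        rwa [cell_put_of_ne hcd.symm]
      -- Right makes the planned answer `d` in advance. Giving `c` to Left afterwards only raises
      -- the game, and the two colorings commute definitionally, as they change different masks.
      exact Tri.right (isRightOption_board hds σ) ((board_true_ge hcs' σ).trans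
        (ih _ ((ncard_board_lt hd σ false).trans (ncard_board_lt hcs σ true)) hk σ rfl))
  refine LE.intro ?_ ?_ fun _ => tri
  · intro K hK
    rcases exists_of_isLeftOption_place hK with ⟨c, hcs, rfl⟩ | ⟨z', e, he, rfl⟩
    · match k, h with
      | 0, h => rw [(B.hold_zero h).1] at hcs; cases hcs
      | 1, h =>
        exact tri_game_of_le (ih _ (ncard_board_lt hcs σ true) ((B.hold_one h).2 c hcs) σ rfl)
      | k + 2, h =>
        obtain ⟨d, hd, hk⟩ := (B.hold_add_two h).2 c hcs
        exact Tri.right (isRightOption_board hd σ)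
          (ih _ ((ncard_board_lt hd σ false).trans (ncard_board_lt hcs σ true)) hk σ rfl)
    · by_cases hz : z' = z
      · subst hz
        exact Tri.left (isLeftOption_color he) (ihz e true he)
      · exact tri_game_of_le (ihne z' e true hz he)
  · intro K hK
    obtain ⟨e, he, rfl⟩ := isRightOption_game_iff.1 hK
    exact Tri.right (isRightOption_summand s he) (ihz e false he)

/-- The mirror image of `game_le_of_hold`, with Left as the second player on the board. -/
theorem le_game_of_hold {z : Outcome} {k : ℕ} {s : ℕ × ℕ} {D : Outcome → Bool}
    (hD : ∀ z', D z' → z' = .top ∨ z' = z) (h : B.hold true D k s)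
    (σ : ∀ z, (summand S₁ S₂ S₃ z).Position) :
    LE (σ z).game (place (B := B) s σ).game := by
  induction hn : {c | place (B := B) s σ c = none}.ncard using Nat.strong_induction_on
    generalizing s σ k with
  | _ n ih =>
  subst hn
  have ihz : ∀ e x, σ z e = none → LE ((σ z).color e x).game
      (place (B := B) s (Function.update σ z ((σ z).color e x))).game := by
    intro e x he
    simpa using ih _ (ncard_summand_lt s he x) h _ rfl
  have ihne : ∀ z' e x, z' ≠ z → σ z' e = none → LE (σ z).game
      (place (B := B) s (Function.update σ z' ((σ z').color e x))).game := by
    intro z' e x hz' he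
    simpa [hz'.symm] using ih _ (ncard_summand_lt s he x) h _ rfl
  have tri : Tri (σ z).game (place (B := B) s σ).game := by
    by_cases h₁ : ∃ e, σ z e = none
    · obtain ⟨e, he⟩ := h₁
      exact Tri.right (isRightOption_color he) ((ihz e false he).trans (summand_false_le s he))
    by_cases h₂ : ∃ z' e, σ z' e = none
    · obtain ⟨z', e, he⟩ := h₂
      have hz' : z' ≠ z := by
        rintro rfl
        exact h₁ ⟨e, he⟩
      exact Tri.left (isLeftOption_summand s he) (ihne z' e true hz' he)
    push Not at h₂
    match k, h with
    | 0, h =>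
      obtain ⟨hs, ho⟩ := B.hold_zero h
      obtain ⟨w, hw, hp⟩ := game_place_full hs h₂
      rw [hw, hp]
      refine Tri.atomic ?_
      rcases hD _ ho with h | h
      · rw [h]
        exact le_top
      · rw [h]
    | 1, h =>
      obtain ⟨hs, hc⟩ := B.hold_one h
      obtain ⟨c, hcs⟩ := List.exists_mem_of_ne_nil _ hs
      exact Tri.left (isLeftOption_board hcs σ)
        (((ih _ (ncard_board_lt hcs σ false) (hc c hcs) σ rfl).trans (board_false_le hcs σ)).trans
          (board_true_ge hcs σ))
    | k + 2, h =>
      obtain ⟨hs, hc⟩ := B.hold_add_two h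
      obtain ⟨c, hcs⟩ := List.exists_mem_of_ne_nil _ hs
      obtain ⟨d, hd, hk⟩ := hc c hcs
      have hcd : d ≠ c := by
        rintro rfl
        have := (B.mem_free.1 hd).2
        rw [cell_put_same (B.mem_free.1 hcs).2] at this
        cases this
      have hds : d ∈ B.free s := by
        rw [B.mem_free] at hd ⊢
        rwa [cell_put_of_ne hcd] at hd
      have hcs' : c ∈ B.free (put true d s) := by
        rw [B.mem_free] at hcs ⊢
        rwa [cell_put_of_ne hcd.symm]
      exact Tri.left (isLeftOption_board hds σ)
        ((ih _ ((ncard_board_lt hd σ true).trans (ncard_board_lt hcs σ false)) hk σ rfl).trans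
          (board_false_le hcs' σ))
  refine LE.intro ?_ ?_ fun _ => tri
  · intro K hK
    obtain ⟨e, he, rfl⟩ := isLeftOption_game_iff.1 hK
    exact Tri.left (isLeftOption_summand s he) (ihz e true he)
  · intro K hK
    rcases exists_of_isRightOption_place hK with ⟨c, hcs, rfl⟩ | ⟨z', e, he, rfl⟩
    · match k, h with
      | 0, h => rw [(B.hold_zero h).1] at hcs; cases hcs
      | 1, h =>
        exact game_tri_of_le (ih _ (ncard_board_lt hcs σ false) ((B.hold_one h).2 c hcs) σ rfl)
      | k + 2, h =>
        obtain ⟨d, hd, hk⟩ := (B.hold_add_two h).2 c hcs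
        exact Tri.left (isLeftOption_board hd σ)
          (ih _ ((ncard_board_lt hd σ true).trans (ncard_board_lt hcs σ false)) hk σ rfl)
    · by_cases hz : z' = z
      · subst hz
        exact Tri.right (isRightOption_color he) (ihz e false he)
      · exact game_tri_of_le (ihne z' e false hz he)

theorem game_le_of_hold_upTo {z : Outcome} {k : ℕ} {s : ℕ × ℕ} (h : B.hold false z.upTo k s)
    (σ : ∀ z, (summand S₁ S₂ S₃ z).Position) : LE (place (B := B) s σ).game (σ z).game :=
  game_le_of_hold (D := z.upTo) (by simp [Outcome.upTo]) h σ

theorem le_game_of_hold_atLeast {z : Outcome} {k : ℕ} {s : ℕ × ℕ} (h : B.hold true z.atLeast k s)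
    (σ : ∀ z, (summand S₁ S₂ S₃ z).Position) : LE (σ z).game (place (B := B) s σ).game :=
  le_game_of_hold (D := z.atLeast) (by simp [Outcome.atLeast]) h σ

/-- A win of Right counts as the constant summand `.bot`, which makes this a case of
`game_le_of_hold`. -/
theorem game_le_bot_of_hold {k : ℕ} {s : ℕ × ℕ}
    (h : B.hold false (fun z' => decide (z' = .bot)) k s)
    (σ : ∀ z, (summand S₁ S₂ S₃ z).Position) : LE (place (B := B) s σ).game (atom ⊥) := by
  have := game_le_of_hold (z := .bot) (by simp) h σ
  rwa [show (σ .bot).game = atom ⊥ from game_constant ⊥ _] at this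

/-- A move of Left outside the board is a pass on the board, whereupon Right carries out the threat.
Moves on the board either concede `z`, matching the left option of `orBot`, or are met by a renewed
threat. -/
theorem game_le_orBot_of_threat {z : Outcome} {k : ℕ} {s : ℕ × ℕ} (h : B.threat z k s)
    (σ : ∀ z, (summand S₁ S₂ S₃ z).Position) :
    LE (place (B := B) s σ).game (orBot (σ z).game) := by
  induction k using Nat.strong_induction_on generalizing s σ with
  | _ k ih =>
  cases k with
  | zero => simp [threat] at h
  | succ k =>
  obtain ⟨hb, hc⟩ := B.threat_add_one h
  obtain ⟨d, hd, hk⟩ := B.force_iff.1 hb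
  refine LE.intro ?_ ?_ ?_
  · intro K hK
    rcases exists_of_isLeftOption_place hK with ⟨c, hcs, rfl⟩ | ⟨z', e, he, rfl⟩
    · rcases hc c hcs with h | ⟨k', hk', d', hd', h⟩
      · exact Tri.left (isLeftOption_orBot _) (game_le_of_hold_upTo h σ)
      · exact Tri.right (isRightOption_board hd' σ) (ih k' hk' h σ)
    · exact Tri.right (isRightOption_board hd _)
        ((game_le_bot_of_hold hk _).trans (CGame.bot_le _))
  · rintro K ⟨_, rfl⟩
    exact Tri.right (isRightOption_board hd _) (game_le_bot_of_hold hk _)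
  · intro _
    exact Tri.right (isRightOption_board hd _) ((game_le_bot_of_hold hk _).trans (CGame.bot_le _))

end Compound

end MonotoneSetColoringGame

-- The three concrete boards

namespace Board

/-- The monotonicity of an outcome, in a form that can be evaluated. -/
def monoCheck (n : ℕ) (t : List Outcome) : Bool :=
  (List.range (2 ^ n)).all fun l => (List.range (2 ^ n)).all fun l' =>
    !(l &&& l' == l) || decide (t.getD l .bot = t.getD l' .bot) ||
      decide (t.getD l .bot = .bot) || decide (t.getD l' .bot = .top)

/-- The board with `n` cells whose outcomes are listed in `t`. -/
def ofTable (n : ℕ) (t : List Outcome) (h : monoCheck n t) : Board where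
  size := n
  outcome l := t.getD l .bot
  mono l l' hl hl' hle := by
    simp only [monoCheck, List.all_eq_true, List.mem_range, Bool.or_eq_true, Bool.not_eq_true',
      beq_eq_false_iff_ne, decide_eq_true_eq] at h
    rcases h l hl l' hl' with ((h | h) | h) | h
    · exact absurd hle h
    · exact Or.inl h
    · exact Or.inr (Or.inl h)
    · exact Or.inr (Or.inr h)

/-- One cell, where Left wins and Right moves to the first summand. -/
def hot : Board := ofTable 1 [.fst, .top] (by decide +kernel)

/-- Three cells: the player who colors two cells wins, except that Left only reaches the second
summand with the cells `0, 1` and the first one with the cells `0, 2`. -/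
def triangle : Board :=
  ofTable 3 [.bot, .bot, .bot, .snd, .bot, .fst, .top, .top] (by decide +kernel)

/-- Six cells, on which Left moving first can choose each of the first two summands, whereas Right
moving first can choose each of the three summands in such a way that Left has to answer. -/
def arena : Board := ofTable 6 [
    .bot, .bot, .bot, .bot, .bot, .bot, .bot, .bot,
    .bot, .bot, .bot, .bot, .bot, .trd, .top, .top,
    .bot, .bot, .bot, .bot, .bot, .bot, .snd, .snd,
    .bot, .top, .fst, .top, .top, .top, .top, .top,
    .bot, .bot, .bot, .fst, .bot, .bot, .top, .top,
    .bot, .fst, .bot, .fst, .snd, .top, .top, .top,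
    .bot, .fst, .fst, .fst, .fst, .fst, .top, .top,
    .bot, .top, .fst, .top, .top, .top, .top, .top] (by decide +kernel)

variable (B : Board)

/-- With `k` empty cells left and Right to move, Left can enter one of the summands as soon as
Right does not answer, and each of the first two summands when moving first. -/
def isSafeForLeft : ℕ → ℕ × ℕ → Bool
  | 0, _ => false
  | 1, _ => false
  | k + 2, s => B.force true (Outcome.atLeast .fst) (k + 1) s &&
      B.force true (Outcome.atLeast .snd) (k + 1) s &&
      (B.free s).all fun d =>
        B.force true (Outcome.atLeast .fst) k (put false d s) ||
        B.force true (Outcome.atLeast .snd) k (put false d s) ||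
        B.force true (Outcome.atLeast .trd) k (put false d s) ||
        (B.free (put false d s)).any fun c => isSafeForLeft k (put true c (put false d s))

/-- With `k` empty cells left and Left to move, Right can threaten to win while offering each one
of the summands, and does not let Left reach more than one of the first two summands. -/
def isSafeForRight : ℕ → ℕ × ℕ → Bool
  | 0, _ => false
  | 1, _ => false
  | k + 2, s => (B.free s).any (fun d => B.threat .fst (k + 1) (put false d s)) &&
      (B.free s).any (fun d => B.threat .snd (k + 1) (put false d s)) &&
      (B.free s).any (fun d => B.threat .trd (k + 1) (put false d s)) &&
      (B.free s).all fun c =>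
        B.hold false (Outcome.upTo .fst) (k + 1) (put true c s) ||
        B.hold false (Outcome.upTo .snd) (k + 1) (put true c s) ||
        B.force false (fun z => decide (z = .bot)) k (put true c s) ||
        (B.free (put true c s)).any fun d => isSafeForRight k (put false d (put true c s))

theorem isSafeForLeft_arena : arena.isSafeForLeft 6 (0, 0) = true := by decide +kernel

theorem isSafeForRight_arena : arena.isSafeForRight 6 (0, 0) = true := by decide +kernel

end Board

-- Realizing the building blocks

namespace MonotoneSetColoringGame

open CGame Board

variable {A : Type u} [PartialOrder A] [BoundedOrder A] {S T : MonotoneSetColoringGame.{u, v} A}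

theorem game_compound (B : Board) (S₁ S₂ S₃ : MonotoneSetColoringGame.{u, v} A) :
    (compound B S₁ S₂ S₃).game =
      (place (B := B) (S₁ := S₁) (S₂ := S₂) (S₃ := S₃) (0, 0) fun _ _ => none).game := by
  rw [place_empty]
  rfl

/-- Since `G` lies below both `S` and `T`, Left may enter any summand in reply to Right; the force
towards `S` is also the reply to the left options of `G`. -/
theorem le_place_of_isSafeForLeft {B : Board} {G : CGame.{u, v} A} (hG : ¬ IsAtomic G)
    (hL : ∀ K, IsLeftOption K G → LE K S.game) (hS : LE G S.game) (hT : LE G T.game)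
    {k : ℕ} {s : ℕ × ℕ} (h : B.isSafeForLeft k s) :
    LE G (place (B := B) (S₁ := S) (S₂ := S) (S₃ := T) s fun _ _ => none).game := by
  induction k using Nat.strong_induction_on generalizing s with
  | _ k ih =>
  match k, h with
  | 0, h => simp [isSafeForLeft] at h
  | 1, h => simp [isSafeForLeft] at h
  | k + 2, h =>
    simp only [isSafeForLeft, Bool.and_eq_true, List.all_eq_true, Bool.or_eq_true, force_iff,
      List.any_eq_true] at h
    obtain ⟨⟨⟨c₁, hc₁, h₁⟩, c₂, hc₂, h₂⟩, h₃⟩ := h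
    refine LE.intro (fun K hK => Tri.left (isLeftOption_board hc₁ _)
      ((hL K hK).trans (le_game_of_hold_atLeast h₁ fun _ _ => none))) ?_ ?_
    · intro K hK
      rcases exists_of_isRightOption_place hK with ⟨d, hd, rfl⟩ | ⟨z, e, he, rfl⟩
      · rcases h₃ d hd with ((⟨c, hc, h⟩ | ⟨c, hc, h⟩) | ⟨c, hc, h⟩) | ⟨c, hc, h⟩
        · exact Tri.left (isLeftOption_board hc _) (hS.trans (le_game_of_hold_atLeast h fun _ _ => none))
        · exact Tri.left (isLeftOption_board hc _) (hS.trans (le_game_of_hold_atLeast h fun _ _ => none))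
        · exact Tri.left (isLeftOption_board hc _) (hT.trans (le_game_of_hold_atLeast h fun _ _ => none))
        · exact Tri.left (isLeftOption_board hc _) (ih k (by omega) h)
      -- Right has moved in a summand. At least one of the two copies of `S` is untouched, and Left
      -- enters it.
      · by_cases hz : z = .fst
        · subst hz
          refine Tri.left (isLeftOption_board hc₂ _) (LE.trans ?_ (le_game_of_hold_atLeast h₂ _))
          rw [Function.update_of_ne (by decide)]
          exact hS
        · refine Tri.left (isLeftOption_board hc₁ _) (LE.trans ?_ (le_game_of_hold_atLeast h₁ _))
          rw [Function.update_of_ne (Ne.symm hz)]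
          exact hS
    · rintro (h | h)
      · exact (hG h).elim
      · exact (not_isAtomic_game (place_board_eq_none hc₁ _) h).elim

/-- Right can threaten `⊥` while offering `S` or `T`: the former position is below `G` because `S ⊲
G`, the latter below every right option of `G` because `T ⊲ G^R`. -/
theorem place_le_of_isSafeForRight {B : Board} {G : CGame.{u, v} A} (hG : ¬ IsAtomic G)
    (hS : Tri S.game G) (hR : ∀ K, IsRightOption K G → Tri T.game K)
    {k : ℕ} {s : ℕ × ℕ} (h : B.isSafeForRight k s) :
    LE (place (B := B) (S₁ := S) (S₂ := S) (S₃ := T) s fun _ _ => none).game G := by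
  induction k using Nat.strong_induction_on generalizing s with
  | _ k ih =>
  match k, h with
  | 0, h => simp [isSafeForRight] at h
  | 1, h => simp [isSafeForRight] at h
  | k + 2, h =>
    simp only [isSafeForRight, Bool.and_eq_true, List.all_eq_true, Bool.or_eq_true, force_iff,
      List.any_eq_true] at h
    obtain ⟨⟨⟨⟨d₁, hd₁, h₁⟩, d₂, hd₂, h₂⟩, d₃, hd₃, h₃⟩, h₄⟩ := h
    refine LE.intro ?_ (fun K hK => Tri.right (isRightOption_board hd₃ _)
      ((game_le_orBot_of_threat h₃ _).trans (orBot_le (hR K hK)))) ?_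
    · intro K hK
      rcases exists_of_isLeftOption_place hK with ⟨c, hc, rfl⟩ | ⟨z, e, he, rfl⟩
      · rcases h₄ c hc with ((h | h) | ⟨d, hd, h⟩) | ⟨d, hd, h⟩
        · exact (game_le_of_hold_upTo h _).trans_tri hS
        · exact (game_le_of_hold_upTo h _).trans_tri hS
        · exact Tri.right (isRightOption_board hd _)
            ((game_le_bot_of_hold h _).trans (CGame.bot_le _))
        · exact Tri.right (isRightOption_board hd _) (ih k (by omega) h)
      -- Left has moved in a summand. Right threatens `⊥` and offers a copy of `S` that is
      -- untouched.
      · by_cases hz : z = .fst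
        · subst hz
          refine Tri.right (isRightOption_board hd₂ _)
            ((game_le_orBot_of_threat h₂ _).trans (orBot_le ?_))
          rw [Function.update_of_ne (by decide)]
          exact hS
        · refine Tri.right (isRightOption_board hd₁ _)
            ((game_le_orBot_of_threat h₁ _).trans (orBot_le ?_))
          rw [Function.update_of_ne (Ne.symm hz)]
          exact hS
    · rintro (h | h)
      · exact (not_isAtomic_game (place_board_eq_none hd₁ _) h).elim
      · exact (hG h).elim

/-- The hypotheses say precisely what is needed to compare `G` with `{S | {T | ⊥}}` in both
directions; the arena imitates this game robustly against moves in the summands. -/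
theorem equivalent_game_compound_arena {G : CGame.{u, v} A} (hG : ¬ IsAtomic G)
    (hL : ∀ K, IsLeftOption K G → LE K S.game) (hS : LE G S.game) (hS' : Tri S.game G)
    (hT : LE G T.game) (hR : ∀ K, IsRightOption K G → Tri T.game K) :
    Equivalent G (compound arena S S T).game := by
  rw [game_compound]
  exact ⟨le_place_of_isSafeForLeft hG hL hS hT isSafeForLeft_arena,
    place_le_of_isSafeForRight hG hS' hR isSafeForRight_arena⟩

/-- For every `S` there is a game in which Left threatens to win and Right can move to `S`. -/
theorem exists_hot (S : MonotoneSetColoringGame.{u, v} A) :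
    ∃ T : MonotoneSetColoringGame.{u, v} A,
      (∀ K, Tri K S.game → LE K T.game) ∧ ∀ H, LE S.game H → Tri T.game H := by
  refine ⟨compound hot S S S, fun K hK => ?_, fun H hH => ?_⟩ <;> rw [game_compound]
  · obtain ⟨c, hc, h⟩ : ∃ c ∈ hot.free (0, 0), hot.hold true (Outcome.atLeast .top) 0
      (put true c (0, 0)) := by decide
    have htop : ∀ σ, LE (atom ⊤) (place (B := hot) (S₁ := S) (S₂ := S) (S₃ := S)
        (put true c (0, 0)) σ).game := by
      intro σ
      have := le_game_of_hold_atLeast (S₁ := S) (S₂ := S) (S₃ := S) h σ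
      rwa [show (σ .top).game = atom ⊤ from game_constant ⊤ _] at this
    have hfst : ∀ d ∈ hot.free (0, 0), hot.hold true (Outcome.atLeast .fst) 0
      (put false d (0, 0)) := by decide
    have hleft : ∀ (G : CGame.{u, v} A) σ, Tri G (place (B := hot) (S₁ := S) (S₂ := S) (S₃ := S)
        (0, 0) σ).game := fun G σ => Tri.left (isLeftOption_board hc σ)
      ((CGame.le_top G).trans (htop σ))
    refine LE.intro (fun G _ => hleft G _) ?_ (fun _ => hleft K _)
    intro G hG
    rcases exists_of_isRightOption_place hG with ⟨d, hd, rfl⟩ | ⟨z, e, he, rfl⟩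
    · exact hK.trans_le (le_game_of_hold_atLeast (hfst d hd) fun _ _ => none)
    -- A move of Right in a summand leaves the only cell of the board to Left, who wins.
    · exact hleft K _
  · obtain ⟨d, hd, h⟩ : ∃ d ∈ hot.free (0, 0), hot.hold false (Outcome.upTo .fst) 0
      (put false d (0, 0)) := by decide
    exact Tri.right (isRightOption_board hd _)
      ((game_le_of_hold_upTo h fun _ _ => none).trans hH)

/-- For all `S` and `T` there is a game in which Left can move to `S` or `T`, whereas Right can
move to `⊥`. -/
theorem exists_triangle (S T : MonotoneSetColoringGame.{u, v} A) :
    ∃ U : MonotoneSetColoringGame.{u, v} A, Tri S.game U.game ∧ Tri T.game U.game ∧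
      ∀ H, Tri S.game H → Tri T.game H → LE U.game H := by
  refine ⟨compound triangle S T T, ?_, ?_, fun H hS hT => ?_⟩ <;> rw [game_compound]
  · obtain ⟨c, hc, h⟩ : ∃ c ∈ triangle.free (0, 0), triangle.hold true (Outcome.atLeast .fst) 2
      (put true c (0, 0)) := by decide
    exact Tri.left (isLeftOption_board hc _) (le_game_of_hold_atLeast h fun _ _ => none)
  · obtain ⟨c, hc, h⟩ : ∃ c ∈ triangle.free (0, 0), triangle.hold true (Outcome.atLeast .snd) 2
      (put true c (0, 0)) := by decide
    exact Tri.left (isLeftOption_board hc _) (le_game_of_hold_atLeast h fun _ _ => none)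
  · obtain ⟨d, hd, h⟩ : ∃ d ∈ triangle.free (0, 0), triangle.hold false
      (fun z => decide (z = .bot)) 2 (put false d (0, 0)) := by decide
    have hright : ∀ (K : CGame.{u, v} A) σ, Tri (place (B := triangle) (S₁ := S) (S₂ := T)
        (S₃ := T) (0, 0) σ).game K := fun K σ => Tri.right (isRightOption_board hd σ)
      ((game_le_bot_of_hold h σ).trans (CGame.bot_le K))
    have hleft : ∀ c ∈ triangle.free (0, 0), ∃ d ∈ triangle.free (put true c (0, 0)),
        triangle.threat .fst 1 (put false d (put true c (0, 0))) ∨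
        triangle.threat .snd 1 (put false d (put true c (0, 0))) := by decide
    refine LE.intro ?_ (fun K _ => hright K _) (fun _ => hright H _)
    intro K hK
    rcases exists_of_isLeftOption_place hK with ⟨c, hc, rfl⟩ | ⟨z, e, he, rfl⟩
    · obtain ⟨d, hd, h | h⟩ := hleft c hc
      · exact Tri.right (isRightOption_board hd _)
          ((game_le_orBot_of_threat h _).trans (orBot_le hS))
      · exact Tri.right (isRightOption_board hd _)
          ((game_le_orBot_of_threat h _).trans (orBot_le hT))
    -- A move of Left in a summand lets Right move first on the board and win.
    · exact hright H _

/-- For every finite list `l` of realizable games there is a game in which Left can move to every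
game in `l`, whereas Right can move to `⊥`. -/
theorem exists_choice (l : List (CGame.{u, v} A)) (hl : ∀ K ∈ l, K.IsRealizable) :
    ∃ U : MonotoneSetColoringGame.{u, v} A, (∀ K ∈ l, Tri K U.game) ∧
      ∀ H, (∀ K ∈ l, Tri K H) → LE U.game H := by
  induction l with
  | nil =>
    refine ⟨constant ⊥, by simp, fun H _ => ?_⟩
    rw [show (constant ⊥ : MonotoneSetColoringGame.{u, v} A).game = atom ⊥ from game_constant ⊥ _]
    exact CGame.bot_le H
  | cons G l ih =>
    obtain ⟨U, hU, hU'⟩ := ih fun K hK => hl K (List.mem_cons_of_mem G hK)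
    obtain ⟨S, hS⟩ := hl G List.mem_cons_self
    -- Left reaches the games in `l` through `T = {⊤ | U}`: the threat of `⊤` makes Right move on to
    -- `U`, where it is again the turn of Left.
    obtain ⟨T, hT, hT'⟩ := exists_hot U
    obtain ⟨V, hV₁, hV₂, hV⟩ := exists_triangle S T
    refine ⟨V, ?_, fun H hH => hV H (hS.2.trans_tri (hH G List.mem_cons_self))
      (hT' H (hU' H fun K hK => hH K (List.mem_cons_of_mem G hK)))⟩
    intro K hK
    rcases List.mem_cons.1 hK with rfl | hK
    · exact hS.1.trans_tri hV₁
    · exact (hT K (hU K hK)).trans_tri hV₂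

end MonotoneSetColoringGame

/-! ### Duality -/

namespace CGame

variable {A : Type u}

/-- The game with the roles of the players exchanged. -/
def dual : CGame.{u, v} A → CGame.{u, v} Aᵒᵈ
  | atom a => atom (OrderDual.toDual a)
  | comp ι κ hι hκ L R => comp κ ι hκ hι (fun j => dual (R j)) (fun i => dual (L i))

theorem isLeftOption_dual {G : CGame.{u, v} A} {K : CGame.{u, v} Aᵒᵈ} :
    IsLeftOption K G.dual ↔ ∃ K', IsRightOption K' G ∧ K = K'.dual := by
  cases G with
  | atom a => exact ⟨fun h => h.elim, fun ⟨_, h, _⟩ => h.elim⟩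
  | comp ι κ hι hκ L R =>
    constructor
    · rintro ⟨j, rfl⟩
      exact ⟨_, ⟨j, rfl⟩, rfl⟩
    · rintro ⟨_, ⟨j, rfl⟩, rfl⟩
      exact ⟨j, rfl⟩

theorem isRightOption_dual {G : CGame.{u, v} A} {K : CGame.{u, v} Aᵒᵈ} :
    IsRightOption K G.dual ↔ ∃ K', IsLeftOption K' G ∧ K = K'.dual := by
  cases G with
  | atom a => exact ⟨fun h => h.elim, fun ⟨_, h, _⟩ => h.elim⟩
  | comp ι κ hι hκ L R =>
    constructor
    · rintro ⟨j, rfl⟩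
      exact ⟨_, ⟨j, rfl⟩, rfl⟩
    · rintro ⟨_, ⟨j, rfl⟩, rfl⟩
      exact ⟨j, rfl⟩

theorem isAtomic_dual {G : CGame.{u, v} A} : IsAtomic G.dual ↔ IsAtomic G := by
  cases G with
  | atom a => exact ⟨fun _ => ⟨a, rfl⟩, fun _ => ⟨_, rfl⟩⟩
  | comp ι κ hι hκ L R => exact iff_of_false not_isAtomic_comp not_isAtomic_comp

/-- The equation is well typed because `Aᵒᵈᵒᵈ` unfolds to `A`. -/
theorem dual_dual (G : CGame.{u, v} A) : dual (dual G) = G := by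
  induction G with
  | atom a => rfl
  | comp ι κ hι hκ L R ihL ihR =>
    simp only [dual]
    congr 1 <;> funext i
    exacts [ihL i, ihR i]

theorem IsPosition.trans {G H K : CGame.{u, v} A} (h : IsPosition G H) (h' : IsPosition H K) :
    IsPosition G K := by
  induction h' with
  | refl => exact h
  | left _ hK ih => exact ih.left hK
  | right _ hK ih => exact ih.right hK

variable [PartialOrder A]

theorem le_and_tri_dual (G H : CGame.{u, v} A) :
    (LE G H → LE H.dual G.dual) ∧ (Tri G H → Tri H.dual G.dual) := by
  induction G using option_induction generalizing H with
  | h G ihGL ihGR =>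
  induction H using option_induction with
  | h H ihHL ihHR =>
  have tri : Tri G H → Tri H.dual G.dual := by
    intro h
    rcases (tri_iff G H).1 h with ⟨K, hK, h'⟩ | ⟨K, hK, h'⟩ | ⟨a, b, rfl, rfl, h'⟩
    · exact Tri.left (isLeftOption_dual.2 ⟨K, hK, rfl⟩) ((ihGR K hK H).1 h')
    · exact Tri.right (isRightOption_dual.2 ⟨K, hK, rfl⟩) ((ihHL K hK).1 h')
    · exact Tri.atomic (OrderDual.toDual_le_toDual.2 h')
  refine ⟨fun h => LE.intro ?_ ?_ fun hA => ?_, tri⟩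
  · intro K hK
    obtain ⟨K', hK', rfl⟩ := isLeftOption_dual.1 hK
    exact (ihHR K' hK').2 (h.right hK')
  · intro K hK
    obtain ⟨K', hK', rfl⟩ := isRightOption_dual.1 hK
    exact (ihGL K' hK' H).2 (h.left hK')
  · rw [isAtomic_dual, isAtomic_dual] at hA
    exact tri (h.atomic hA.symm)

theorem LE.dual {G H : CGame.{u, v} A} (h : LE G H) : LE H.dual G.dual :=
  (le_and_tri_dual G H).1 h

theorem Tri.dual {G H : CGame.{u, v} A} (h : Tri G H) : Tri H.dual G.dual :=
  (le_and_tri_dual G H).2 h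

end CGame

namespace MonotoneSetColoringGame

open CGame

variable {A : Type u} [PartialOrder A]

/-- The set coloring game with the roles of the players exchanged. -/
@[reducible] def dual (S : MonotoneSetColoringGame.{u, v} A) :
    MonotoneSetColoringGame.{u, v} Aᵒᵈ where
  carrier := S.carrier
  finite_carrier := S.finite_carrier
  payoff := ⟨fun w => OrderDual.toDual (S.payoff fun c => !w c), fun w w' h =>
    OrderDual.toDual_le_toDual.2 (S.payoff.monotone fun c => by
      have := h c
      revert this
      dsimp only
      cases w c <;> cases w' c <;> simp)⟩

/-- The options of the two games are indexed by different subtypes of cells, hence `Identical` in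
place of equality. Taking `q` as a variable keeps the induction free of casts. -/
theorem identical_game_dual (S : MonotoneSetColoringGame.{u, v} A) (p : S.Position)
    (q : S.dual.Position) (h : ∀ c, q c = (p c).map Bool.not) :
    Identical (CGame.dual p.game) q.game := by
  induction p using Position.color_induction generalizing q with
  | h p ih =>
  have hcolor : ∀ c x, (q.color c x) = fun d => (p.color c (!x) d).map Bool.not := by
    intro c x
    funext d
    by_cases hd : d = c
    · subst hd
      rw [Position.color_same (S := S.dual), Position.color_same (S := S)]
      simp
    · rw [Position.color_of_ne (S := S.dual) _ hd, Position.color_of_ne (S := S) _ hd, h]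
  have hnone : ∀ c, q c = none ↔ p c = none := fun c => by rw [h]; simp
  by_cases hp : Nonempty {c : S.carrier // p c = none}
  · have hq : Nonempty {c : S.dual.carrier // q c = none} :=
      hp.map fun c => ⟨c.1, (hnone _).2 c.2⟩
    rw [Position.game, Position.game, dif_pos hp, dif_pos hq, CGame.dual, Identical]
    have key : ∀ c x, p c = none →
        Identical (CGame.dual (p.color c (!x)).game) (q.color c x).game :=
      fun c x hc => ih c (!x) hc _ fun d => by rw [hcolor]
    exact ⟨⟨fun c => ⟨⟨c.1, (hnone _).2 c.2⟩, key c.1 true c.2⟩,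
      fun c => ⟨⟨c.1, (hnone _).1 c.2⟩, key c.1 true ((hnone _).1 c.2)⟩⟩,
      fun c => ⟨⟨c.1, (hnone _).2 c.2⟩, key c.1 false c.2⟩,
      fun c => ⟨⟨c.1, (hnone _).1 c.2⟩, key c.1 false ((hnone _).1 c.2)⟩⟩
  · have hp' : ∀ c, p c ≠ none := fun c hc => hp ⟨⟨c, hc⟩⟩
    obtain ⟨w, hw⟩ := exists_eq_some_of_forall_ne_none hp'
    rw [game_eq_atom hw, game_eq_atom (S := S.dual) (p := q) (w := fun c => !w c)
      fun c => by rw [h, hw]; rfl, CGame.dual, Identical]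
    change _ = OrderDual.toDual (S.payoff fun c => !!w c)
    simp

theorem equivalent_game_dual (S : MonotoneSetColoringGame.{u, v} A) :
    Equivalent (CGame.dual S.game) S.dual.game :=
  (identical_game_dual S _ _ fun _ => rfl).equivalent

end MonotoneSetColoringGame

-- Realizing a composite game from its options

namespace CGame

open MonotoneSetColoringGame

variable {A : Type u} [PartialOrder A]

theorem IsRealizable.dual {G : CGame.{u, v} A} (h : G.IsRealizable) : G.dual.IsRealizable := by
  obtain ⟨S, h₁, h₂⟩ := h
  exact ⟨S.dual, h₂.dual.trans (equivalent_game_dual S).1, (equivalent_game_dual S).2.trans h₁.dual⟩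

theorem exists_dual_choice [BoundedOrder A] (l : List (CGame.{u, v} A))
    (hl : ∀ K ∈ l, K.IsRealizable) :
    ∃ U : MonotoneSetColoringGame.{u, v} A, (∀ K ∈ l, Tri U.game K) ∧
      ∀ H, (∀ K ∈ l, Tri H K) → LE H U.game := by
  obtain ⟨U, hU, hU'⟩ := exists_choice (l.map CGame.dual) (by
    intro K hK
    obtain ⟨K', hK', rfl⟩ := List.mem_map.1 hK
    exact (hl K' hK').dual)
  have hdual := equivalent_game_dual U
  refine ⟨U.dual, fun K hK => ?_, fun H hH => ?_⟩
  · have := (hU _ (List.mem_map_of_mem hK)).dual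
    rw [dual_dual] at this
    exact hdual.2.trans_tri this
  · have := (hU' H.dual fun K hK => by
      obtain ⟨K', hK', rfl⟩ := List.mem_map.1 hK
      exact (hH K' hK').dual).dual
    rw [dual_dual] at this
    exact this.trans hdual.1

/-- Up to equivalence, `l` lists all games with the property `P`. -/
def Lists (l : List (CGame.{u, v} A)) (P : CGame.{u, v} A → Prop) : Prop :=
  (∀ K ∈ l, P K) ∧ ∀ K, P K → ∃ K' ∈ l, Equivalent K K'

/-- This is the case in which Left does not lose by moving. The option `K` enters only through `G ≤
K ⊲ X`, which gives `G ≤ S` for `S = {⊤ | X}`; `S ⊲ G` comes from the minimality of `X`, and `G ≤ T`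
from the maximality of `T`. -/
theorem isRealizable_of_le_left [BoundedOrder A] {G : CGame.{u, v} A} (hG : ¬ IsAtomic G)
    {l r : List (CGame.{u, v} A)} (hl : Lists l fun K => IsLeftOption K G)
    (hr : Lists r fun K => IsRightOption K G) (hl' : ∀ K ∈ l, K.IsRealizable)
    (hr' : ∀ K ∈ r, K.IsRealizable) (h : ∃ K, IsLeftOption K G ∧ LE G K) : G.IsRealizable := by
  obtain ⟨X, hX, hX'⟩ := exists_choice l hl'
  obtain ⟨T, hT, hT'⟩ := exists_dual_choice r hr'
  obtain ⟨S, hS, hS'⟩ := exists_hot X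
  obtain ⟨K, hK, hGK⟩ := h
  have hLX : ∀ K, IsLeftOption K G → Tri K X.game := by
    intro K hK
    obtain ⟨K', hK', h⟩ := hl.2 K hK
    exact h.1.trans_tri (hX K' hK')
  refine ⟨_, equivalent_game_compound_arena hG (fun K hK => hS K (hLX K hK))
    (hS G (hGK.trans_tri (hLX K hK)))
    (hS' G (hX' G fun K hK => tri_of_isLeftOption (hl.1 K hK)))
    (hT' G fun K hK => tri_of_isRightOption (hr.1 K hK)) fun K hK => ?_⟩
  obtain ⟨K', hK', h⟩ := hr.2 K hK
  exact (hT K' hK').trans_le h.2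

theorem Lists.dual {l : List (CGame.{u, v} A)} {P : CGame.{u, v} A → Prop}
    {Q : CGame.{u, v} Aᵒᵈ → Prop} (h : Lists l P) (hPQ : ∀ K, Q K ↔ ∃ K', P K' ∧ K = K'.dual) :
    Lists (l.map CGame.dual) Q := by
  constructor
  · intro K hK
    obtain ⟨K', hK', rfl⟩ := List.mem_map.1 hK
    exact (hPQ _).2 ⟨K', h.1 K' hK', rfl⟩
  · intro K hK
    obtain ⟨H, hH, rfl⟩ := (hPQ _).1 hK
    obtain ⟨K', hK', h₁, h₂⟩ := h.2 H hH
    exact ⟨_, List.mem_map_of_mem hK', h₂.dual, h₁.dual⟩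

theorem isRealizable_of_right_le [BoundedOrder A] {G : CGame.{u, v} A} (hG : ¬ IsAtomic G)
    {l r : List (CGame.{u, v} A)} (hl : Lists l fun K => IsLeftOption K G)
    (hr : Lists r fun K => IsRightOption K G) (hl' : ∀ K ∈ l, K.IsRealizable)
    (hr' : ∀ K ∈ r, K.IsRealizable) (h : ∃ K, IsRightOption K G ∧ LE K G) : G.IsRealizable := by
  have hmap : ∀ l : List (CGame.{u, v} A), (∀ K ∈ l, K.IsRealizable) →
      ∀ K ∈ l.map CGame.dual, K.IsRealizable := by
    intro l hl K hK
    obtain ⟨K', hK', rfl⟩ := List.mem_map.1 hK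
    exact (hl K' hK').dual
  obtain ⟨K, hK, hKG⟩ := h
  have := (isRealizable_of_le_left (G := G.dual) (isAtomic_dual.not.2 hG)
    (hr.dual fun K => isLeftOption_dual) (hl.dual fun K => isRightOption_dual)
    (hmap r hr') (hmap l hl') ⟨_, isLeftOption_dual.2 ⟨K, hK, rfl⟩, hKG.dual⟩).dual
  rwa [dual_dual] at this

theorem exists_lists {s : Set (CGame.{u, v} A)} (hs : s.Finite) (P : CGame.{u, v} A → Prop)
    (h : ∀ K, P K → ∃ K' ∈ s, Identical K K') : ∃ l, Lists l P := by
  classical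
  have hfin : {K' ∈ s | ∃ K, P K ∧ Identical K K'}.Finite := hs.subset fun K hK => hK.1
  -- Members of `s` need not satisfy `P` themselves, so each is replaced by an identical game that
  -- does; where there is none, `K'` is a dummy value.
  have hrep : ∀ K' : CGame.{u, v} A, ∃ K, (∃ K, P K ∧ Identical K K') → P K ∧ Identical K K' := by
    intro K'
    by_cases h : ∃ K, P K ∧ Identical K K'
    · exact ⟨h.choose, fun _ => h.choose_spec⟩
    · exact ⟨K', fun h' => (h h').elim⟩
  choose rep hrep using hrep
  refine ⟨hfin.toFinset.toList.map rep, ?_, ?_⟩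
  · intro K hK
    obtain ⟨K', hK', rfl⟩ := List.mem_map.1 hK
    simp only [Finset.mem_toList, Set.Finite.mem_toFinset] at hK'
    exact (hrep K' hK'.2).1
  · intro K hK
    obtain ⟨K', hK', hKK'⟩ := h K hK
    have hmem : ∃ K, P K ∧ Identical K K' := ⟨K, hK, hKK'⟩
    refine ⟨rep K', List.mem_map_of_mem (by simpa using ⟨hK', hmem⟩), ?_⟩
    exact hKK'.equivalent.trans (hrep K' hmem).2.equivalent.symm

end CGame

open CGame in
theorem theorem3p2 {A : Type u} [PartialOrder A] [BoundedOrder A] (G : CGame.{u, v} A)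
    (hfin : G.IsFinite) (hpass : G.IsPassable) : G.IsRealizable := by
  induction G using option_induction with
  | h G ihL ihR =>
  -- The finite set that represents the positions of `G` serves for every position of `G`.
  have hpos : ∀ K, IsPosition G K → K.IsFinite ∧ K.IsPassable := by
    intro K hK
    obtain ⟨s, hs, h⟩ := hfin
    exact ⟨⟨s, hs, fun K' hK' => h K' (hK.trans hK')⟩, fun K' hK' => hpass K' (hK.trans hK')⟩
  have hL : ∀ K, IsLeftOption K G → IsPosition G K := fun K hK => .left .refl hK
  have hR : ∀ K, IsRightOption K G → IsPosition G K := fun K hK => .right .refl hK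
  by_cases hG : IsAtomic G
  · obtain ⟨a, rfl⟩ := hG
    refine ⟨MonotoneSetColoringGame.constant a, ?_⟩
    rw [show (MonotoneSetColoringGame.constant a).game = atom a from
      MonotoneSetColoringGame.game_constant a _]
    exact ⟨LE.refl _, LE.refl _⟩
  obtain ⟨s, hs, hfin⟩ := hfin
  obtain ⟨l, hl⟩ := exists_lists hs (fun K => IsLeftOption K G) fun K hK => hfin K (hL K hK)
  obtain ⟨r, hr⟩ := exists_lists hs (fun K => IsRightOption K G) fun K hK => hfin K (hR K hK)
  have hl' : ∀ K ∈ l, K.IsRealizable := fun K hK =>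
    ihL K (hl.1 K hK) (hpos K (hL K (hl.1 K hK))).1 (hpos K (hL K (hl.1 K hK))).2
  have hr' : ∀ K ∈ r, K.IsRealizable := fun K hK =>
    ihR K (hr.1 K hK) (hpos K (hR K (hr.1 K hK))).1 (hpos K (hR K (hr.1 K hK))).2
  rcases hpass G .refl with h | h | h
  · exact (hG h).elim
  · exact isRealizable_of_le_left hG hl hr hl' hr' h
  · exact isRealizable_of_right_le hG hl hr hl' hr' h
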